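/- **Setting.** A two-agent MDP has a finite state set $S$, finite action sets $A_1, A_2$, a transition kernel $P(s,a^1,a^2,s')$ and a joint reward $r(s,a^1,a^2)\in[0,1]$; it is known to agent 1. A policy $\pi^i$ assigns to every state a distribution on $A_i$, and $P_{\pi^1,\pi^2}$ is the induced transition matrix on $S$. A number $\omega>0$ is a mixing time of the MDP if $\|dP_{\pi^1,\pi^2}-d'P_{\pi^1,\pi^2}\|_1\le e^{-1/\omega}\|d-d'\|_1$ for all policies and all state distributions $d,d'$; then there is a unique stationary distribution $d_{\pi^1,\pi^2}$, to which every initial distribution converges, and $\eta_{\pi^2}(\pi^1)=\sum_s d_{\pi^1,\pi^2}(s)\,\mathbb E_{a^1\sim\pi^1(s),\,a^2\sim\pi^2(s)}[r(s,a^1,a^2)]$ is the average reward. With $\|\cdot\|_\infty$ the maximal absolute row sum of a matrix, let $$I_2=\sup_{\pi^1,\ \pi^2\ne\tilde\pi^2}\frac{\|P_{\pi^1,\pi^2}-P_{\pi^1,\tilde\pi^2}\|_\infty}{\|\pi^2-\tilde\pi^2\|_\infty},\qquad \rho_2=\max_{1<t\le T}\|\pi^2_t-\pi^2_{t-1}\|_\infty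 .$$ In episode $t=1,\dots,T$ agent 1 chooses $\pi^1_t$ knowing the MDP, $T$ and $\pi^2_1,\dots,\pi^2_{t-1}$. Its regret is $R(T)=\sup_{\pi^1}\sum_{t=1}^T[\eta_{\pi^2_t}(\pi^1)-\eta_{\pi^2_t}(\pi^1_t)]$. In *online agnostic parity learning*, for a sequence $(x_t,y_t)\in\{0,1\}^n\times\{0,1\}$, $t=1,\dots,T$, the learner predicts $\hat y_t\in\{0,1\}$ from $n$, $T$, $(x_1,y_1),\dots,(x_{t-1},y_{t-1})$ and $x_t$; its regret is the number of its mistakes minus the least number of mistakes of a parity function $x\mapsto\bigoplus_{i\in I}x_i$, $I\subseteq\{1,\dots,n\}$. Algorithms may be randomized, regret is in expectation over their random bits, for every fixed sequence $(\pi^2_t)$ respectively $(x_t,y_t)$, and running time counts bit operations. **Theorem.** Let $|A_1|,|A_2|\ge 2$ be fixed numbers of actions, and let an integer $e\ge1$, $0<c\le2$ and $\beta<1$ be fixed. Consider all two-agent MDPs with these numbers of actions, together with all $T\ge1$ and all policy sequences $\pi^2_1,\dots,\pi^2_T$, such that $I_2=1$, $\rho_2\ge c$, the MDP has a mixing time of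 at most $|S|^e$, and all transition probabilities, rewards and probabilities of agent 2's policies are rational numbers whose numerators and denominators have at most $(|S|+T)^e$ bits. If some algorithm with running time $\mathrm{poly}(|S|,T)$ outputs policies $\pi^1_1,\dots,\pi^1_T$ with regret $O(\mathrm{poly}(|S|)\cdot T^\beta)$ on all these instances, then there is an algorithm for online agnostic parity learning with running time $\mathrm{poly}(n,T)$ and regret $O(\mathrm{poly}(n)\cdot T^\beta)$, for all $n,T\ge1$. -/

import Mathlib

open scoped BigOperators Matrix Topology

namespace CollabMDP

/-! ### A machine model with logarithmic cost

Data are natural numbers and pairs of data; a number occupies as many cells as it has binary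
digits. A program is built from elementary operations by composition, pairing, branching and an
unbounded loop. Every elementary operation is charged the number of cells that it reads and
writes, so running times agree with those of Turing machines up to a polynomial. -/

/-- Data of the machine. -/
inductive Val : Type
  | num (n : ℕ) : Val
  | pair (a b : Val) : Val

namespace Val

/-- Number of memory cells (bits, up to one cell of overhead per node). -/
def size : Val → ℕ
  | num n => Nat.size n + 1
  | pair a b => a.size + b.size + 1

def fst : Val → Val
  | num _ => num 0
  | pair a _ => a

def snd : Val → Val
  | num _ => num 0
  | pair _ b => b

def toNat : Val → ℕ
  | num n => n
  | pair _ _ => 0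

/-- `1` on numbers and `0` on pairs. -/
def isNum : Val → ℕ
  | num _ => 1
  | pair _ _ => 0

/-- Lists are nested pairs, ended by the number `0`. -/
def ofList : List Val → Val
  | [] => num 0
  | a :: l => pair a (ofList l)

/-- The entry number `i` of a list. -/
def nth : Val → ℕ → Val
  | v, 0 => v.fst
  | v, i + 1 => v.snd.nth i

/-- The list of the values of a function on `Fin n`. -/
def ofFn {n : ℕ} (f : Fin n → Val) : Val := ofList (List.ofFn f)

def ofBool (b : Bool) : Val := num b.toNat

/-- A nonnegative rational number in lowest terms. -/
def ofRat (q : ℚ) : Val := pair (num q.num.toNat) (num q.den)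

/-- The rational number `a / b` described by the pair of `a` and `b`, not necessarily in lowest
terms. -/
def toRat (v : Val) : ℚ := (v.fst.toNat : ℚ) / (v.snd.toNat : ℚ)

end Val

/-- Elementary operations; the arithmetic ones act on pairs of numbers. -/
inductive Op : Type
  | id | const (v : Val) | fst | snd | isNum | add | sub | mul | div

def Op.eval : Op → Val → Val
  | .id, v => v
  | .const c, _ => c
  | .fst, v => v.fst
  | .snd, v => v.snd
  | .isNum, v => .num v.isNum
  | .add, v => .num (v.fst.toNat + v.snd.toNat)
  | .sub, v => .num (v.fst.toNat - v.snd.toNat)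
  | .mul, v => .num (v.fst.toNat * v.snd.toNat)
  | .div, v => .num (v.fst.toNat / v.snd.toNat)

/-- Programs. -/
inductive Prog : Type
  | op (o : Op) : Prog
  | comp (g f : Prog) : Prog
  | pair (f g : Prog) : Prog
  | ite (c f g : Prog) : Prog
  | loop (f : Prog) : Prog

/-- `Run p v w t`: on input `v` the program `p` halts with output `w` after exactly `t` steps.
`comp g f` runs `f` and then `g`; `ite c f g` runs `f` or `g` on the input, according to whether
`c` outputs something other than the number `0`; `loop f` runs `f` over and over on the second
component of its last output, until the first component of the output is the number `0`. -/
inductive Run : Prog → Val → Val → ℕ → Prop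
  | op (o : Op) (v : Val) : Run (.op o) v (o.eval v) (v.size + (o.eval v).size)
  | comp {g f : Prog} {v w u : Val} {s t : ℕ} :
      Run f v w s → Run g w u t → Run (.comp g f) v u (s + t + 1)
  | pair {f g : Prog} {v w u : Val} {s t : ℕ} :
      Run f v w s → Run g v u t → Run (.pair f g) v (.pair w u) (s + t + v.size + 1)
  | ite_true {c f g : Prog} {v w u : Val} {s t : ℕ} :
      Run c v w s → w ≠ .num 0 → Run f v u t → Run (.ite c f g) v u (s + t + v.size + 1)
  | ite_false {c f g : Prog} {v u : Val} {s t : ℕ} :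
      Run c v (.num 0) s → Run g v u t → Run (.ite c f g) v u (s + t + v.size + 1)
  | loop_stop {f : Prog} {v w : Val} {s : ℕ} :
      Run f v w s → w.fst = .num 0 → Run (.loop f) v w.snd (s + 1)
  | loop_next {f : Prog} {v w u : Val} {s t : ℕ} :
      Run f v w s → w.fst ≠ .num 0 → Run (.loop f) w.snd u t → Run (.loop f) v u (s + t + 1)

/-- The machine is deterministic. -/
theorem Run.deterministic {p : Prog} {v w w' : Val} {s s' : ℕ}
    (h : Run p v w s) (h' : Run p v w' s') : w = w' ∧ s = s' := by
  induction h generalizing w' s' with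
  | op o v => cases h'; exact ⟨rfl, rfl⟩
  | comp _ _ ih₁ ih₂ =>
    cases h' with
    | comp a b =>
      obtain ⟨rfl, rfl⟩ := ih₁ a
      obtain ⟨rfl, rfl⟩ := ih₂ b
      exact ⟨rfl, rfl⟩
  | pair _ _ ih₁ ih₂ =>
    cases h' with
    | pair a b =>
      obtain ⟨rfl, rfl⟩ := ih₁ a
      obtain ⟨rfl, rfl⟩ := ih₂ b
      exact ⟨rfl, rfl⟩
  | ite_true _ hw _ ih₁ ih₂ =>
    cases h' with
    | ite_true a _ b =>
      obtain ⟨rfl, rfl⟩ := ih₁ a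
      obtain ⟨rfl, rfl⟩ := ih₂ b
      exact ⟨rfl, rfl⟩
    | ite_false a b => exact absurd (ih₁ a).1 hw
  | ite_false _ _ ih₁ ih₂ =>
    cases h' with
    | ite_true a hw b => exact absurd (ih₁ a).1.symm hw
    | ite_false a b =>
      obtain ⟨_, rfl⟩ := ih₁ a
      obtain ⟨rfl, rfl⟩ := ih₂ b
      exact ⟨rfl, rfl⟩
  | loop_stop _ hw ih =>
    cases h' with
    | loop_stop a _ =>
      obtain ⟨rfl, rfl⟩ := ih a
      exact ⟨rfl, rfl⟩
    | loop_next a hn _ =>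
      obtain ⟨rfl, rfl⟩ := ih a
      exact absurd hw hn
  | loop_next _ hn _ ih₁ ih₂ =>
    cases h' with
    | loop_stop a hw =>
      obtain ⟨rfl, rfl⟩ := ih₁ a
      exact absurd hw hn
    | loop_next a _ b =>
      obtain ⟨rfl, rfl⟩ := ih₁ a
      obtain ⟨rfl, rfl⟩ := ih₂ b
      exact ⟨rfl, rfl⟩

/-! ### Two-agent Markov decision processes -/

/-- A two-agent MDP with states `1, …, N`, `k₁` actions of the first and `k₂` actions of the second
agent, a transition kernel and a joint reward in `[0, 1]`. The entries are rational, since the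
first agent's algorithm receives them as input. -/
structure TwoAgentMDP (N k₁ k₂ : ℕ) where
  P : Fin N → Fin k₁ → Fin k₂ → Fin N → ℚ
  r : Fin N → Fin k₁ → Fin k₂ → ℚ
  P_nonneg : ∀ s a₁ a₂ s', 0 ≤ P s a₁ a₂ s'
  P_sum : ∀ s a₁ a₂, ∑ s', P s a₁ a₂ s' = 1
  r_nonneg : ∀ s a₁ a₂, 0 ≤ r s a₁ a₂
  r_le_one : ∀ s a₁ a₂, r s a₁ a₂ ≤ 1

/-- Stationary (randomized) policies: a distribution on actions for every state, with
probabilities in `K`. -/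
abbrev Policy (K : Type) [Semiring K] [PartialOrder K] (N k : ℕ) : Type :=
  Fin N → stdSimplex K (Fin k)

/-- A policy with rational probabilities, seen as a policy with real probabilities. -/
def Policy.toReal {N k : ℕ} (π : Policy ℚ N k) : Policy ℝ N k := fun s =>
  ⟨fun a => ((π s a : ℚ) : ℝ),
    fun a => Rat.cast_nonneg.mpr ((π s).2.1 a),
    by
      have h : ∑ a, π s a = 1 := (π s).2.2
      change ∑ a, ((π s a : ℚ) : ℝ) = 1
      exact_mod_cast h⟩

/-- The operator norm of a matrix that is induced by the sup norm: the maximal absolute row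
sum. -/
noncomputable def rowSumNorm {m n : ℕ} (A : Fin m → Fin n → ℝ) : ℝ := ⨆ i, ∑ j, |A i j|

/-- Policy change magnitude over the episodes `0, …, T - 1`:
the maximum over `t` of the norm of the difference between episodes `t + 1` and `t`. -/
noncomputable def changeMagnitude {N k : ℕ} (T : ℕ) (π : ℕ → Policy ℝ N k) : ℝ :=
  ⨆ t : Fin (T - 1), rowSumNorm fun s a => π (t + 1) s a - π t s a

namespace TwoAgentMDP

variable {N k₁ k₂ : ℕ} (M : TwoAgentMDP N k₁ k₂)

/-- The transition matrix under a pair of policies. -/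
noncomputable def kernel (π₁ : Policy ℝ N k₁) (π₂ : Policy ℝ N k₂) : Matrix (Fin N) (Fin N) ℝ :=
  fun s s' => ∑ a₁, ∑ a₂, π₁ s a₁ * π₂ s a₂ * (M.P s a₁ a₂ s' : ℝ)

/-- The influence of the second agent. -/
noncomputable def influence₂ : ℝ :=
  ⨆ x : {x : Policy ℝ N k₁ × Policy ℝ N k₂ × Policy ℝ N k₂ // x.2.1 ≠ x.2.2},
    rowSumNorm (fun s s' => M.kernel x.1.1 x.1.2.1 s s' - M.kernel x.1.1 x.1.2.2 s s') /
      rowSumNorm (fun s a => x.1.2.1 s a - x.1.2.2 s a)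

/-- `ω` is a mixing time of the MDP: under every pair of policies the transition matrix contracts
the ℓ¹-distance of state distributions by the factor `exp (-1/ω)`. -/
def HasMixingTime (ω : ℝ) : Prop :=
  0 < ω ∧ ∀ (π₁ : Policy ℝ N k₁) (π₂ : Policy ℝ N k₂),
    ∀ d ∈ stdSimplex ℝ (Fin N), ∀ d' ∈ stdSimplex ℝ (Fin N),
      ∑ s, |(d ᵥ* M.kernel π₁ π₂) s - (d' ᵥ* M.kernel π₁ π₂) s| ≤
        Real.exp (-1 / ω) * ∑ s, |d s - d' s|

/-- `d` is the stationary distribution under a pair of policies: it is invariant and every initial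
state distribution converges to it. -/
def IsStationary (π₁ : Policy ℝ N k₁) (π₂ : Policy ℝ N k₂) (d : Fin N → ℝ) : Prop :=
  d ∈ stdSimplex ℝ (Fin N) ∧
    (∀ d₀ ∈ stdSimplex ℝ (Fin N),
      Filter.Tendsto (fun m : ℕ => d₀ ᵥ* (M.kernel π₁ π₂) ^ m) Filter.atTop (𝓝 d)) ∧
    d ᵥ* M.kernel π₁ π₂ = d

open Classical in
/-- The stationary distribution; it exists and is unique if the MDP has a mixing time. -/
noncomputable def stationary (π₁ : Policy ℝ N k₁) (π₂ : Policy ℝ N k₂) : Fin N → ℝ :=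
  if h : ∃ d, M.IsStationary π₁ π₂ d then h.choose else 0

/-- The average reward `η` of a pair of policies. -/
noncomputable def avgReward (π₁ : Policy ℝ N k₁) (π₂ : Policy ℝ N k₂) : ℝ :=
  ∑ s, M.stationary π₁ π₂ s * ∑ a₁, π₁ s a₁ * ∑ a₂, π₂ s a₂ * (M.r s a₁ a₂ : ℝ)

/-- The regret of the first agent over the episodes `0, …, T - 1`. -/
noncomputable def regret (T : ℕ) (π₁ : ℕ → Policy ℝ N k₁) (π₂ : ℕ → Policy ℝ N k₂) : ℝ :=
  ⨆ π : Policy ℝ N k₁,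
    ∑ t ∈ Finset.range T, (M.avgReward π (π₂ t) - M.avgReward (π₁ t) (π₂ t))

def encode : Val :=
  .pair
    (.ofFn fun s => .ofFn fun a₁ => .ofFn fun a₂ => .ofFn fun s' => .ofRat (M.P s a₁ a₂ s'))
    (.ofFn fun s => .ofFn fun a₁ => .ofFn fun a₂ => .ofRat (M.r s a₁ a₂))

end TwoAgentMDP

def Policy.encode {N k : ℕ} (π : Policy ℚ N k) : Val :=
  .ofFn fun s : Fin N => .ofFn fun a : Fin k => .ofRat (π s a)

/-- The value `v` is a matrix of fractions that describes the policy `π`. -/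
def Policy.IsDescribedBy {N k : ℕ} (π : Policy ℚ N k) (v : Val) : Prop :=
  ∀ (s : Fin N) (a : Fin k), ((v.nth s).nth a).toRat = π s a

/-- The nonnegative rational `q` has numerator and denominator of at most `b` binary digits. -/
def HasBitLength (b : ℕ) (q : ℚ) : Prop := Nat.size q.num.toNat ≤ b ∧ Nat.size q.den ≤ b

/-- The problem instances: an MDP and the policies `π₂ t` of the second agent in the episodes
`t < T`, such that the MDP has a mixing time of at most `N ^ e`, all numbers have at most
`(N + T) ^ e` binary digits, the influence of the second agent is `1` and its policy change
magnitude is at least `c`. -/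
structure IsInstance {N k₁ k₂ : ℕ} (e : ℕ) (c : ℝ) (T : ℕ) (M : TwoAgentMDP N k₁ k₂)
    (π₂ : ℕ → Policy ℚ N k₂) : Prop where
  mixing : ∃ ω : ℝ, M.HasMixingTime ω ∧ ω ≤ (N : ℝ) ^ e
  bits_P : ∀ s a₁ a₂ s', HasBitLength ((N + T) ^ e) (M.P s a₁ a₂ s')
  bits_r : ∀ s a₁ a₂, HasBitLength ((N + T) ^ e) (M.r s a₁ a₂)
  bits_π₂ : ∀ t < T, ∀ s a, HasBitLength ((N + T) ^ e) (π₂ t s a)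
  influence : M.influence₂ = 1
  change : c ≤ changeMagnitude T fun t => (π₂ t).toReal

/-- What the first agent knows when it chooses its policy for episode `t`: the number of states, the
number of episodes, the MDP, the policies of the second agent in the earlier episodes, and its
own random bits `σ`. -/
def agentInput {N k₁ k₂ l : ℕ} (T : ℕ) (M : TwoAgentMDP N k₁ k₂) (π₂ : ℕ → Policy ℚ N k₂) (t : ℕ)
    (σ : Fin l → Bool) : Val :=
  .ofList [.num N, .num T, M.encode, .ofList ((List.range t).map fun i => (π₂ i).encode),
    .ofFn fun i => .ofBool (σ i)]

/-- There is a randomized algorithm for the first agent that runs in time `poly(N, T)` and whose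
expected regret is at most `poly(N) * T ^ β` on all instances with `k₁` and `k₂` actions. -/
def HasEfficientAgent (k₁ k₂ e : ℕ) (c β : ℝ) : Prop :=
  ∃ (A : Prog) (coins time bound : Polynomial ℕ),
    ∀ (N T : ℕ), 1 ≤ T → ∀ (M : TwoAgentMDP N k₁ k₂) (π₂ : ℕ → Policy ℚ N k₂),
      IsInstance e c T M π₂ →
      ∃ π₁ : (Fin (coins.eval (N + T)) → Bool) → ℕ → Policy ℚ N k₁,
        (∀ σ, ∀ t < T, ∃ (v : Val) (steps : ℕ),
          Run A (agentInput T M π₂ t σ) v steps ∧ steps ≤ time.eval (N + T) ∧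
            (π₁ σ t).IsDescribedBy v) ∧
        (𝔼 σ, M.regret T (fun t => (π₁ σ t).toReal) (fun t => (π₂ t).toReal)) ≤
          ((bound.eval N : ℕ) : ℝ) * (T : ℝ) ^ β

/-! ### Online agnostic parity learning -/

/-- The parity function of the set `I` of coordinates. -/
def parity {n : ℕ} (I : Finset (Fin n)) (x : Fin n → Bool) : Bool :=
  decide (Odd (I.filter fun i => x i = true).card)

/-- The number of mistakes in the rounds `0, …, T - 1`. -/
def mistakes (T : ℕ) (y' y : ℕ → Bool) : ℕ := ((Finset.range T).filter fun t => y' t ≠ y t).card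

/-- The regret of the predictions `y'` with respect to the best parity function, on the examples
`x t` with labels `y t`. -/
noncomputable def parityRegret {n : ℕ} (T : ℕ) (x : ℕ → Fin n → Bool) (y y' : ℕ → Bool) : ℝ :=
  ⨆ I : Finset (Fin n), ((mistakes T y' y : ℝ) - (mistakes T (fun t => parity I (x t)) y : ℝ))

/-- What the learner knows when it predicts the label in round `t`: the dimension, the number of
rounds, the earlier examples with their labels, the present example, and its own random bits. -/
def learnerInput {n l : ℕ} (T : ℕ) (x : ℕ → Fin n → Bool) (y : ℕ → Bool) (t : ℕ)
    (σ : Fin l → Bool) : Val :=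
  .ofList [.num n, .num T,
    .ofList ((List.range t).map fun i => .pair (.ofFn fun j => .ofBool (x i j)) (.ofBool (y i))),
    .ofFn fun j => .ofBool (x t j),
    .ofFn fun i => .ofBool (σ i)]

/-- There is a randomized algorithm for online agnostic parity learning that runs in time
`poly(n, T)` and whose expected regret is at most `poly(n) * T ^ β`. -/
def HasEfficientParityLearner (β : ℝ) : Prop :=
  ∃ (B : Prog) (coins time bound : Polynomial ℕ),
    ∀ (n T : ℕ), 1 ≤ n → 1 ≤ T → ∀ (x : ℕ → Fin n → Bool) (y : ℕ → Bool),
      ∃ y' : (Fin (coins.eval (n + T)) → Bool) → ℕ → Bool,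
        (∀ σ, ∀ t < T, ∃ steps : ℕ,
          Run B (learnerInput T x y t σ) (.ofBool (y' σ t)) steps ∧ steps ≤ time.eval (n + T)) ∧
        (𝔼 σ, parityRegret T x y (y' σ)) ≤ ((bound.eval n : ℕ) : ℝ) * (T : ℝ) ^ β

end CollabMDP

/-!
A parity function is computed by a walk through `n` layers of two states each: the state records
the parity of the selected coordinates that have been read so far. In layer `i` the first agent
decides whether coordinate `i` is selected, and the second agent reveals the value of this
coordinate in the present example; in the last layer the second agent rewards the parity that
agrees with the label. An example with its label thus becomes a deterministic policy of the second
agent, and a set of coordinates becomes a deterministic policy of the first agent.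

To make the walk mix in a single step, all states but one restart it with probability
`2 / (2 * n + 3)`. Influence exactly `1` forces some state whose successor is chosen by the second
agent alone, without a common restart. This is the state `1`, which is never entered again. Its two
possible successors are the two states to which the walk restarts everywhere else, so all rows
dominate a multiple of the row of state `1`, and Doeblin's criterion
(`sum_abs_vecMul_sub_le`) gives the mixing time. The stationary mass of the last layer is a number
`lastLayerProb n ≥ (2 * n + 3)⁻²` that does not depend on the policies, and its two states carry it
in proportion to the probabilities of the two parities (`stationary_parityMDP`). Hence the average
reward is `lastLayerProb n` times the probability of a correct prediction
(`avgReward_parityMDP`), and regret of the first agent bounds regret in predicting the labels up to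
the factor `(2 * n + 3)²` (`le_regret_parityMDP`).

The second agent plays `2 * T` episodes. After the `T` examples it plays a zero example on which all
parity functions are optimal, and in state `1` it changes its action in episode `T`, so that its
policy change magnitude is at least `2`. The number of states plus episodes,
`2 * (n + T) + 3`, depends on `n + T` only, as the number of random bits of the learner has to.

In each round the learner writes down the MDP and the policies of the past episodes, runs the
algorithm of the first agent, computes the exact probability `p` that the resulting policy ends with
parity `1` on the present example, and predicts `1` if a random threshold with `n + T` bits lies
below `p`. The rounding costs `T / 2 ^ (n + T)`, which is below a multiple of `T ^ β` for every `β`.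
That all this takes polynomial time is shown with the predicate `PolyTime`, whose closure properties
(`PolyTime.comp`, `PolyTime.foldl`, `PolyTime.map`, …) replace the writing of programs.
-/

/-! ### Polynomial-time functions -/

namespace CollabMDP

theorem monotone_eval (q : Polynomial ℕ) : Monotone fun n : ℕ => q.eval n := by
  intro a b h
  simp only [Polynomial.eval_eq_sum, Polynomial.sum_def]
  gcongr

namespace Val

/-- The list that a value stands for; the inverse of `ofList`, up to the number at the end. -/
def toList : Val → List Val
  | num _ => []
  | pair a b => a :: b.toList

@[simp] theorem toList_ofList (l : List Val) : (ofList l).toList = l := by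
  induction l with
  | nil => rfl
  | cons a l ih => simp [ofList, toList, ih]

theorem size_pos (v : Val) : 0 < v.size := by cases v <;> simp [size]

theorem length_toList_le (v : Val) : v.toList.length ≤ v.size := by
  induction v with
  | num n => simp [toList]
  | pair a b _ ih => simp only [toList, List.length_cons, size]; omega

theorem size_le_of_mem_toList {v a : Val} (h : a ∈ v.toList) : a.size ≤ v.size := by
  induction v with
  | num n => simp [toList] at h
  | pair b c _ ih =>
    simp only [toList, List.mem_cons] at h
    simp only [size]
    rcases h with rfl | h
    · omega
    · have := ih h; omega

theorem size_ofList (l : List Val) :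
    (ofList l).size = (l.map fun a => a.size + 1).sum + 1 := by
  induction l with
  | nil => simp [ofList, size]
  | cons a l ih => simp [ofList, size, ih]; omega

theorem size_ofList_le {l : List Val} {B : ℕ} (h : ∀ a ∈ l, a.size ≤ B) :
    (ofList l).size ≤ l.length * (B + 1) + 1 := by
  rw [size_ofList]
  gcongr
  have := List.sum_le_card_nsmul (l.map fun a => a.size + 1) (B + 1) (by
    intro x hx
    obtain ⟨a, ha, rfl⟩ := List.mem_map.1 hx
    have := h a ha
    omega)
  simpa using this

@[simp] theorem toNat_num (n : ℕ) : (num n).toNat = n := rfl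
@[simp] theorem fst_pair (a b : Val) : (pair a b).fst = a := rfl
@[simp] theorem snd_pair (a b : Val) : (pair a b).snd = b := rfl

theorem size_fst_le (v : Val) : v.fst.size ≤ v.size := by
  cases v <;> simp [fst, size]; omega

theorem size_snd_le (v : Val) : v.snd.size ≤ v.size := by
  cases v <;> simp [snd, size]; omega

theorem size_toNat_le (v : Val) : Nat.size v.toNat ≤ v.size := by
  cases v <;> simp [toNat, size]

end Val

theorem Run.size_le {p : Prog} {v w : Val} {t : ℕ} (h : Run p v w t) : w.size ≤ t := by
  induction h with
  | op o v => omega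
  | comp => omega
  | pair => simp only [Val.size]; omega
  | ite_true => omega
  | ite_false => omega
  | loop_stop => exact (Val.size_snd_le _).trans (by omega)
  | loop_next => omega

/-- Functions on data that are computed by a program in time polynomial in the size of the
input. -/
def PolyTime (f : Val → Val) : Prop :=
  ∃ (p : Prog) (q : Polynomial ℕ), ∀ v, ∃ t, Run p v (f v) t ∧ t ≤ q.eval v.size

namespace PolyTime

variable {f g : Val → Val}

theorem size_le (hf : PolyTime f) : ∃ q : Polynomial ℕ, ∀ v, (f v).size ≤ q.eval v.size := by
  obtain ⟨p, q, h⟩ := hf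
  refine ⟨q, fun v => ?_⟩
  obtain ⟨t, ht, htq⟩ := h v
  exact ht.size_le.trans htq

/-- An elementary operation takes polynomial time if its output is polynomially small. -/
theorem of_op (o : Op) (q : Polynomial ℕ) (h : ∀ v, (o.eval v).size ≤ q.eval v.size) :
    PolyTime o.eval :=
  ⟨.op o, Polynomial.X + q, fun v => ⟨_, .op o v, by
    have := h v
    simp only [Polynomial.eval_add, Polynomial.eval_X]; omega⟩⟩

theorem comp (hg : PolyTime g) (hf : PolyTime f) : PolyTime fun v => g (f v) := by
  obtain ⟨p, q, h⟩ := hf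
  obtain ⟨p', q', h'⟩ := hg
  refine ⟨.comp p' p, q + q'.comp q + 1, fun v => ?_⟩
  obtain ⟨s, hs, hsq⟩ := h v
  obtain ⟨t, ht, htq⟩ := h' (f v)
  refine ⟨_, .comp hs ht, ?_⟩
  have := monotone_eval q' (hs.size_le.trans hsq)
  simp only [Polynomial.eval_add, Polynomial.eval_comp, Polynomial.eval_one] at this ⊢
  omega

theorem pair (hf : PolyTime f) (hg : PolyTime g) : PolyTime fun v => .pair (f v) (g v) := by
  obtain ⟨p, q, h⟩ := hf
  obtain ⟨p', q', h'⟩ := hg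
  refine ⟨.pair p p', q + q' + Polynomial.X + 1, fun v => ?_⟩
  obtain ⟨s, hs, hsq⟩ := h v
  obtain ⟨t, ht, htq⟩ := h' v
  refine ⟨_, .pair hs ht, ?_⟩
  simp only [Polynomial.eval_add, Polynomial.eval_X, Polynomial.eval_one]
  omega

theorem id : PolyTime fun v => v :=
  of_op .id Polynomial.X fun v => by simp [Op.eval]

theorem const (c : Val) : PolyTime fun _ => c :=
  of_op (.const c) (Polynomial.C c.size) fun v => by simp [Op.eval]

theorem fst (hf : PolyTime f) : PolyTime fun v => (f v).fst :=
  (of_op .fst Polynomial.X fun v => by simpa [Op.eval] using v.size_fst_le).comp hf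

theorem snd (hf : PolyTime f) : PolyTime fun v => (f v).snd :=
  (of_op .snd Polynomial.X fun v => by simpa [Op.eval] using v.size_snd_le).comp hf

theorem isNum (hf : PolyTime f) : PolyTime fun v => .num (f v).isNum :=
  (of_op .isNum (Polynomial.C 2) fun v => by
    cases v <;> simp [Op.eval, Val.isNum, Val.size]).comp hf

theorem ite {c : Val → Val} (hc : PolyTime c) (hf : PolyTime f) (hg : PolyTime g) 
    [∀ v, Decidable (c v = .num 0)] :
    PolyTime fun v => if c v = .num 0 then g v else f v := by
  obtain ⟨p₀, q₀, h₀⟩ := hc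
  obtain ⟨p, q, h⟩ := hf
  obtain ⟨p', q', h'⟩ := hg
  refine ⟨.ite p₀ p p', q₀ + q + q' + Polynomial.X + 1, fun v => ?_⟩
  obtain ⟨r, hr, hrq⟩ := h₀ v
  obtain ⟨s, hs, hsq⟩ := h v
  obtain ⟨t, ht, htq⟩ := h' v
  simp only [Polynomial.eval_add, Polynomial.eval_X, Polynomial.eval_one]
  by_cases hv : c v = .num 0
  · rw [hv] at hr
    exact ⟨_, by rw [if_pos hv]; exact .ite_false hr ht, by omega⟩
  · exact ⟨_, by rw [if_neg hv]; exact .ite_true hr hv hs, by omega⟩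

theorem toNat (hf : PolyTime f) : PolyTime fun v => .num (f v).toNat := by
  classical
  have h := ite hf.isNum hf (const (.num 0))
  convert h using 2 with v
  cases f v <;> simp [Val.isNum, Val.toNat]

theorem _root_.Nat.size_add_le (m n : ℕ) : Nat.size (m + n) ≤ Nat.size m + Nat.size n + 1 := by
  rw [Nat.size_le]
  have h₁ := Nat.lt_size_self m
  have h₂ := Nat.lt_size_self n
  have h₃ : 2 ^ Nat.size m ≤ 2 ^ (Nat.size m + Nat.size n) :=
    Nat.pow_le_pow_right (by norm_num) (by omega)
  have h₄ : 2 ^ Nat.size n ≤ 2 ^ (Nat.size m + Nat.size n) :=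
    Nat.pow_le_pow_right (by norm_num) (by omega)
  rw [pow_succ]
  omega

theorem _root_.Nat.size_mul_le (m n : ℕ) : Nat.size (m * n) ≤ Nat.size m + Nat.size n := by
  rw [Nat.size_le, pow_add]
  exact Nat.mul_lt_mul'' (Nat.lt_size_self m) (Nat.lt_size_self n)

theorem size_toNat_add_le (v : Val) :
    Nat.size v.fst.toNat + Nat.size v.snd.toNat ≤ 2 * v.size := by
  have h₁ := v.fst.size_toNat_le
  have h₂ := v.snd.size_toNat_le
  have h₃ := v.size_fst_le
  have h₄ := v.size_snd_le
  omega

variable {a b : Val → ℕ}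

theorem add (ha : PolyTime fun v => .num (a v)) (hb : PolyTime fun v => .num (b v)) :
    PolyTime fun v => .num (a v + b v) :=
  (of_op .add (2 * Polynomial.X + 2) fun v => by
    have h₁ := Nat.size_add_le v.fst.toNat v.snd.toNat
    have h₂ := size_toNat_add_le v
    simp [Op.eval, Val.size]
    omega).comp (ha.pair hb)

theorem sub (ha : PolyTime fun v => .num (a v)) (hb : PolyTime fun v => .num (b v)) :
    PolyTime fun v => .num (a v - b v) :=
  (of_op .sub (2 * Polynomial.X + 2) fun v => by
    have h₁ := Nat.size_le_size (Nat.sub_le v.fst.toNat v.snd.toNat)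
    have h₂ := size_toNat_add_le v
    simp [Op.eval, Val.size]
    omega).comp (ha.pair hb)

theorem mul (ha : PolyTime fun v => .num (a v)) (hb : PolyTime fun v => .num (b v)) :
    PolyTime fun v => .num (a v * b v) :=
  (of_op .mul (2 * Polynomial.X + 2) fun v => by
    have h₁ := Nat.size_mul_le v.fst.toNat v.snd.toNat
    have h₂ := size_toNat_add_le v
    simp [Op.eval, Val.size]
    omega).comp (ha.pair hb)

theorem div (ha : PolyTime fun v => .num (a v)) (hb : PolyTime fun v => .num (b v)) :
    PolyTime fun v => .num (a v / b v) :=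
  (of_op .div (2 * Polynomial.X + 2) fun v => by
    have h₁ := Nat.size_le_size (Nat.div_le_self v.fst.toNat v.snd.toNat)
    have h₂ := size_toNat_add_le v
    simp [Op.eval, Val.size]
    omega).comp (ha.pair hb)

/-- Branching on a comparison of numbers. -/
theorem ite_lt (ha : PolyTime fun v => .num (a v)) (hb : PolyTime fun v => .num (b v))
    (hf : PolyTime f) (hg : PolyTime g) : PolyTime fun v => if a v < b v then f v else g v := by
  classical
  convert ite (sub hb ha) hf hg using 2 with v
  by_cases h : a v < b v
  · rw [if_pos h, if_neg]; simp; omega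
  · rw [if_neg h, if_pos]; simp; omega

theorem num_ite_lt {c d : Val → ℕ} (ha : PolyTime fun v => .num (a v))
    (hb : PolyTime fun v => .num (b v)) (hc : PolyTime fun v => .num (c v))
    (hd : PolyTime fun v => .num (d v)) :
    PolyTime fun v => .num (if a v < b v then c v else d v) := by
  convert ite_lt ha hb hc hd using 2 with v
  split_ifs <;> rfl

theorem ite_eq (ha : PolyTime fun v => .num (a v)) (hb : PolyTime fun v => .num (b v))
    (hf : PolyTime f) (hg : PolyTime g) : PolyTime fun v => if a v = b v then f v else g v := by
  convert ite_lt ha hb hg (ite_lt hb ha hg hf) using 2 with v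
  rcases lt_trichotomy (a v) (b v) with h | h | h
  · rw [if_neg h.ne, if_pos h]
  · rw [if_pos h, if_neg h.not_lt, if_neg h.symm.not_lt]
  · rw [if_neg h.ne', if_neg h.not_gt, if_pos h]

theorem num_ite_eq {c d : Val → ℕ} (ha : PolyTime fun v => .num (a v))
    (hb : PolyTime fun v => .num (b v)) (hc : PolyTime fun v => .num (c v))
    (hd : PolyTime fun v => .num (d v)) :
    PolyTime fun v => .num (if a v = b v then c v else d v) := by
  convert ite_eq ha hb hc hd using 2 with v
  split_ifs <;> rfl

/-- The loop that folds `g` over a list: its state consists of the rest of the list, the environment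
and the accumulator, and the program `p` makes one pass. -/
theorem foldl_aux {g : Val → Val → Val → Val} {p : Prog} {q : Polynomial ℕ}
    (hp : ∀ st : Val, ∃ t, Run p st (if st.fst.isNum = 0
      then .pair (.num 1)
        (.pair st.fst.snd (.pair st.snd.fst (g st.snd.fst st.snd.snd st.fst.fst)))
      else .pair (.num 0) st.snd.snd) t ∧ t ≤ q.eval st.size)
    (e : Val) (S : ℕ) (l acc : Val) (hl : l.size + e.size + 2 ≤ S)
    (hS : ∀ l₁, l₁ <+: l.toList → (l₁.foldl (g e) acc).size ≤ S) :
    ∃ t, Run (.loop p) (.pair l (.pair e acc)) (l.toList.foldl (g e) acc) t ∧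
      t ≤ (l.toList.length + 1) * (q.eval (2 * S) + 1) := by
  induction l generalizing acc with
  | num n =>
    obtain ⟨t, ht, htq⟩ := hp (.pair (.num n) (.pair e acc))
    have hacc : acc.size ≤ S := by simpa using hS [] (List.nil_prefix)
    rw [if_neg (by simp [Val.isNum])] at ht
    refine ⟨_, Run.loop_stop ht rfl, ?_⟩
    have : t ≤ q.eval (2 * S) := htq.trans (monotone_eval q (by simp [Val.size] at hl ⊢; omega))
    simpa [Val.toList] using this
  | pair a l _ ih =>
    obtain ⟨t, ht, htq⟩ := hp (.pair (.pair a l) (.pair e acc))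
    have hacc : acc.size ≤ S := by simpa using hS [] (List.nil_prefix)
    rw [if_pos (by simp [Val.isNum])] at ht
    obtain ⟨s, hs, hsq⟩ := ih (g e acc a) (by simp only [Val.size] at hl; omega) (fun l₁ h => by
      have := hS (a :: l₁) (by simpa [Val.toList] using h)
      simpa using this)
    refine ⟨_, .loop_next ht (by simp) hs, ?_⟩
    have : t ≤ q.eval (2 * S) := htq.trans (monotone_eval q (by simp [Val.size] at hl ⊢; omega))
    simp only [Val.toList, List.length_cons]
    rw [add_one_mul (_ + 1)]
    omega

/-- Folding a polynomial-time function over a list takes polynomial time, provided that the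
accumulator stays polynomially small. -/
theorem foldl {l acc : Val → Val} {g : Val → Val → Val → Val} (hl : PolyTime l)
    (hacc : PolyTime acc) (hg : PolyTime fun w => g w.fst w.snd.fst w.snd.snd)
    (hS : ∃ S : Polynomial ℕ, ∀ v l₁, l₁ <+: (l v).toList →
      (l₁.foldl (g v) (acc v)).size ≤ S.eval v.size) :
    PolyTime fun v => (l v).toList.foldl (g v) (acc v) := by
  have hbody : PolyTime fun st => if st.fst.isNum = 0
      then .pair (.num 1)
        (.pair st.fst.snd (.pair st.snd.fst (g st.snd.fst st.snd.snd st.fst.fst)))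
      else .pair (.num 0) st.snd.snd :=
    ite_eq id.fst.isNum (const _)
      ((const _).pair (id.fst.snd.pair (id.snd.fst.pair
        (hg.comp (id.snd.fst.pair (id.snd.snd.pair id.fst.fst))))))
      ((const _).pair id.snd.snd)
  obtain ⟨p, q, hp⟩ := hbody
  obtain ⟨S, hS⟩ := hS
  obtain ⟨L, hL⟩ := hl.size_le
  obtain ⟨p₀, q₀, h₀⟩ := hl.pair (id.pair hacc)
  set S' : Polynomial ℕ := S + L + Polynomial.X + 2 with hS'
  refine ⟨.comp (.loop p) p₀, q₀ + (L + 1) * (q.comp (2 * S') + 1) + 1, fun v => ?_⟩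
  obtain ⟨s, hs, hsq⟩ := h₀ v
  have hSe : S'.eval v.size = S.eval v.size + L.eval v.size + v.size + 2 := by simp [hS']
  have hLv := hL v
  obtain ⟨t, ht, htq⟩ := foldl_aux hp v (S'.eval v.size) (l v) (acc v) (by omega) (fun l₁ h => by
    have := hS v l₁ h
    omega)
  refine ⟨_, .comp hs ht, ?_⟩
  have h₁ : t ≤ (L.eval v.size + 1) * (q.eval (2 * S'.eval v.size) + 1) := by
    refine htq.trans ?_
    gcongr
    exact (l v).length_toList_le.trans hLv
  simp only [Polynomial.eval_add, Polynomial.eval_mul, Polynomial.eval_comp,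
    Polynomial.eval_one, Polynomial.eval_ofNat]
  omega

theorem foldl_cons_eq (g : Val → Val) (l m : List Val) :
    l.foldl (fun acc a => Val.pair (g a) acc) (Val.ofList m) =
      Val.ofList ((l.map g).reverse ++ m) := by
  induction l generalizing m with
  | nil => simp
  | cons a l ih => simpa [Val.ofList] using ih (g a :: m)

theorem reverse_map {l : Val → Val} {g : Val → Val → Val} (hl : PolyTime l)
    (hg : PolyTime fun w => g w.fst w.snd) :
    PolyTime fun v => .ofList (((l v).toList.map (g v)).reverse) := by
  have h := foldl (g := fun v acc a => .pair (g v a) acc) (acc := fun _ => .num 0) hl (const _)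
    ((hg.comp (id.fst.pair id.snd.snd)).pair id.snd.fst) ?_
  · convert h using 2 with v
    have h₁ := foldl_cons_eq (g v) (l v).toList []
    rw [List.append_nil, Val.ofList] at h₁
    exact h₁.symm
  obtain ⟨L, hL⟩ := hl.size_le
  obtain ⟨G, hG⟩ := hg.size_le
  refine ⟨L * (G.comp (Polynomial.X + L + 1) + 1) + 1, fun v l₁ hl₁ => ?_⟩
  have h₁ := foldl_cons_eq (g v) l₁ []
  rw [Val.ofList] at h₁
  rw [h₁]
  refine (Val.size_ofList_le (B := G.eval (v.size + L.eval v.size + 1)) ?_).trans ?_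
  · intro x hx
    simp only [List.append_nil, List.mem_reverse, List.mem_map] at hx
    obtain ⟨a, ha, rfl⟩ := hx
    refine (hG (.pair v a)).trans (monotone_eval G ?_)
    have := Val.size_le_of_mem_toList (hl₁.subset ha)
    have := hL v
    simp only [Val.size]
    omega
  · simp only [List.append_nil, List.length_reverse, List.length_map, Polynomial.eval_add,
      Polynomial.eval_mul, Polynomial.eval_comp, Polynomial.eval_one, Polynomial.eval_X]
    gcongr
    exact hl₁.length_le.trans ((l v).length_toList_le.trans (hL v))

theorem reverse {l : Val → Val} (hl : PolyTime l) :
    PolyTime fun v => .ofList (l v).toList.reverse := by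
  simpa using reverse_map (g := fun _ a => a) hl id.snd

theorem map {l : Val → Val} {g : Val → Val → Val} (hl : PolyTime l)
    (hg : PolyTime fun w => g w.fst w.snd) :
    PolyTime fun v => .ofList ((l v).toList.map (g v)) := by
  simpa using (reverse_map hl hg).reverse

theorem length_range {l : Val → Val} (hl : PolyTime l) :
    PolyTime fun v => .pair (.num (l v).toList.length)
      (.ofList ((List.range (l v).toList.length).map .num).reverse) := by
  have key (L : List Val) : L.foldl (fun acc _ => Val.pair (.num (acc.fst.toNat + 1))
      (.pair (.num acc.fst.toNat) acc.snd)) (.pair (.num 0) (.num 0)) =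
      Val.pair (.num L.length) (.ofList ((List.range L.length).map .num).reverse) := by
    induction L using List.reverseRecOn with
    | nil => rfl
    | append_singleton L a ih =>
      rw [List.foldl_append, ih]
      simp [List.range_succ, Val.ofList]
  have h := foldl (g := fun _ acc _ => .pair (.num (acc.fst.toNat + 1))
      (.pair (.num acc.fst.toNat) acc.snd)) (acc := fun _ => .pair (.num 0) (.num 0)) hl (const _)
    ((add id.snd.fst.fst.toNat (const _)).pair (id.snd.fst.fst.toNat.pair id.snd.fst.snd)) ?_
  · simpa only [key] using h
  obtain ⟨L, hL⟩ := hl.size_le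
  refine ⟨L + 2 + (L * (L + 2) + 1), fun v l₁ hl₁ => ?_⟩
  have hlen : l₁.length ≤ L.eval v.size :=
    hl₁.length_le.trans ((l v).length_toList_le.trans (hL v))
  have hsize (k : ℕ) : Nat.size k ≤ k := Nat.size_le.2 Nat.lt_two_pow_self
  rw [key]
  have h₁ : (Val.ofList ((List.range l₁.length).map .num).reverse).size ≤
      l₁.length * (l₁.length + 1 + 1) + 1 := by
    refine (Val.size_ofList_le (B := l₁.length + 1) ?_).trans (by simp)
    intro x hx
    simp only [List.mem_reverse, List.mem_map, List.mem_range] at hx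
    obtain ⟨k, hk, rfl⟩ := hx
    have := hsize k
    simp only [Val.size]
    omega
  have h₂ : l₁.length * (l₁.length + 1 + 1) ≤ L.eval v.size * (L.eval v.size + 1 + 1) := by gcongr
  have h₃ := hsize l₁.length
  simp only [Val.size, Polynomial.eval_add, Polynomial.eval_mul, Polynomial.eval_one,
    Polynomial.eval_ofNat]
  simp only [add_assoc, Nat.reduceAdd] at h₁ h₂ ⊢
  omega

theorem length {l : Val → Val} (hl : PolyTime l) : PolyTime fun v => .num (l v).toList.length :=
  hl.length_range.fst

/-- The list `0, 1, …, m - 1`, where `m` is the length of a given list. -/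
theorem range {l : Val → Val} (hl : PolyTime l) :
    PolyTime fun v => .ofList ((List.range (l v).toList.length).map .num) := by
  simpa using hl.length_range.snd.reverse

theorem _root_.CollabMDP.Val.ofFn_eq_map_range {n : ℕ} (F : ℕ → Val) :
    (Val.ofFn fun i : Fin n => F i) = .ofList ((List.range n).map F) := by
  rw [Val.ofFn]
  congr 1
  exact List.ext_getElem (by simp) (by simp)

/-- Tabulation of a function takes polynomial time, provided that the list of its arguments can be
written down in polynomial time. -/
theorem ofFn {m : Val → ℕ} {g : Val → ℕ → Val}
    (hm : PolyTime fun v => .ofList ((List.range (m v)).map .num))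
    (hg : PolyTime fun w => g w.fst w.snd.toNat) :
    PolyTime fun v => Val.ofFn fun i : Fin (m v) => g v i := by
  convert hm.map (g := fun v a => g v a.toNat) hg using 2 with v
  rw [Val.ofFn_eq_map_range, Val.toList_ofList, List.map_map]
  rfl

/-- Every entry of a list is doubled, and another list is appended. -/
theorem double_append {l m : Val → Val} (hl : PolyTime l) (hm : PolyTime m) :
    PolyTime fun v => (l v).toList.foldr (fun a acc => .pair a (.pair a acc)) (m v) := by
  have h := foldl (g := fun _ acc a => .pair a (.pair a acc)) hl.reverse hm
    (id.snd.snd.pair (id.snd.snd.pair id.snd.fst)) ?_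
  · convert h using 2 with v
    simp
  obtain ⟨L, hL⟩ := hl.size_le
  obtain ⟨M, hM⟩ := hm.size_le
  refine ⟨M + L * (2 * (L + 1)), fun v l₁ hl₁ => ?_⟩
  have key (l₁ : List Val) (acc : Val) (B : ℕ) (h : ∀ a ∈ l₁, a.size ≤ B) :
      (l₁.foldl (fun acc a => Val.pair a (.pair a acc)) acc).size ≤
        acc.size + l₁.length * (2 * (B + 1)) := by
    induction l₁ generalizing acc with
    | nil => simp
    | cons a l₁ ih =>
      have h₁ := h a (by simp)
      have h₂ := ih (.pair a (.pair a acc)) fun b hb => h b (by simp [hb])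
      simp only [List.foldl_cons, List.length_cons, add_one_mul (l₁.length)]
      simp only [Val.size] at h₂
      omega
  refine (key l₁ (m v) (L.eval v.size) fun a ha => ?_).trans ?_
  · have := hl₁.subset ha
    simp only [Val.toList_ofList, List.mem_reverse] at this
    exact (Val.size_le_of_mem_toList this).trans (hL v)
  · simp only [Polynomial.eval_add, Polynomial.eval_mul, Polynomial.eval_one,
      Polynomial.eval_ofNat]
    gcongr
    · exact hM v
    · have := hl₁.length_le
      simp only [Val.toList_ofList, List.length_reverse] at this
      exact this.trans ((l v).length_toList_le.trans (hL v))

end PolyTime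

end CollabMDP

/-! ### Influence and mixing -/

namespace CollabMDP

theorem rowSumNorm_nonneg {m n : ℕ} (A : Fin m → Fin n → ℝ) : 0 ≤ rowSumNorm A :=
  Real.iSup_nonneg fun _ => Finset.sum_nonneg fun _ _ => abs_nonneg _

theorem le_rowSumNorm {m n : ℕ} (A : Fin m → Fin n → ℝ) (i : Fin m) :
    ∑ j, |A i j| ≤ rowSumNorm A :=
  le_ciSup (f := fun i => ∑ j, |A i j|) (Set.finite_range _).bddAbove i

theorem rowSumNorm_le {m n : ℕ} {A : Fin m → Fin n → ℝ} {c : ℝ} (hc : 0 ≤ c)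
    (h : ∀ i, ∑ j, |A i j| ≤ c) : rowSumNorm A ≤ c :=
  Real.iSup_le h hc

theorem Policy.toReal_apply {N k : ℕ} (π : Policy ℚ N k) (s : Fin N) (a : Fin k) :
    π.toReal s a = ((π s a : ℚ) : ℝ) := rfl

theorem Policy.nonneg {N k : ℕ} (π : Policy ℝ N k) (s : Fin N) (a : Fin k) : 0 ≤ π s a :=
  (π s).2.1 a

theorem Policy.sum_eq_one {N k : ℕ} (π : Policy ℝ N k) (s : Fin N) : ∑ a, π s a = 1 :=
  (π s).2.2

namespace TwoAgentMDP

variable {N k₁ k₂ : ℕ} (M : TwoAgentMDP N k₁ k₂)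

theorem kernel_le {π₁ : Policy ℝ N k₁} {π₂ : Policy ℝ N k₂} {s s' : Fin N} {c : ℝ}
    (h : ∀ a₁ a₂, (M.P s a₁ a₂ s' : ℝ) ≤ c) : M.kernel π₁ π₂ s s' ≤ c := by
  calc M.kernel π₁ π₂ s s' ≤ ∑ a₁, ∑ a₂, π₁ s a₁ * π₂ s a₂ * c := by
        unfold kernel
        gcongr with a₁ _ a₂ _
        · exact mul_nonneg (π₁.nonneg _ _) (π₂.nonneg _ _)
        · exact h a₁ a₂
    _ = c := by
        simp_rw [← Finset.sum_mul, ← Finset.mul_sum, Policy.sum_eq_one, mul_one,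
          Policy.sum_eq_one, one_mul]

theorem le_kernel {π₁ : Policy ℝ N k₁} {π₂ : Policy ℝ N k₂} {s s' : Fin N} {c : ℝ}
    (h : ∀ a₁ a₂, c ≤ (M.P s a₁ a₂ s' : ℝ)) : c ≤ M.kernel π₁ π₂ s s' := by
  calc c = ∑ a₁, ∑ a₂, π₁ s a₁ * π₂ s a₂ * c := by
        simp_rw [← Finset.sum_mul, ← Finset.mul_sum, Policy.sum_eq_one, mul_one,
          Policy.sum_eq_one, one_mul]
    _ ≤ M.kernel π₁ π₂ s s' := by
        unfold kernel
        gcongr with a₁ _ a₂ _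
        · exact mul_nonneg (π₁.nonneg _ _) (π₂.nonneg _ _)
        · exact h a₁ a₂

theorem kernel_sum (π₁ : Policy ℝ N k₁) (π₂ : Policy ℝ N k₂) (s : Fin N) :
    ∑ s', M.kernel π₁ π₂ s s' = 1 := by
  unfold kernel
  rw [Finset.sum_comm]
  simp_rw [Finset.sum_comm (s := Finset.univ (α := Fin N)), ← Finset.mul_sum]
  have h (a₁ a₂) : ∑ s', (M.P s a₁ a₂ s' : ℝ) = 1 := by exact_mod_cast M.P_sum s a₁ a₂
  simp_rw [h, mul_one, ← Finset.mul_sum, Policy.sum_eq_one, mul_one, Policy.sum_eq_one]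

/-- The transition matrix is 1-Lipschitz in the policy of the second agent. -/
theorem rowSumNorm_kernel_sub_le (π₁ : Policy ℝ N k₁) (π₂ π₂' : Policy ℝ N k₂) :
    rowSumNorm (fun s s' => M.kernel π₁ π₂ s s' - M.kernel π₁ π₂' s s') ≤
      rowSumNorm fun s a => π₂ s a - π₂' s a := by
  refine rowSumNorm_le (rowSumNorm_nonneg _) fun s => le_trans ?_ (le_rowSumNorm _ s)
  have hP (a₁ a₂) : ∑ s', (M.P s a₁ a₂ s' : ℝ) = 1 := by exact_mod_cast M.P_sum s a₁ a₂
  have hP0 (a₁ a₂ s') : (0 : ℝ) ≤ M.P s a₁ a₂ s' := by exact_mod_cast M.P_nonneg s a₁ a₂ s'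
  calc ∑ s', |M.kernel π₁ π₂ s s' - M.kernel π₁ π₂' s s'|
      = ∑ s', |∑ a₁, ∑ a₂, π₁ s a₁ * (π₂ s a₂ - π₂' s a₂) * (M.P s a₁ a₂ s' : ℝ)| := by
        simp_rw [kernel, ← Finset.sum_sub_distrib, ← sub_mul, ← mul_sub]
    _ ≤ ∑ s', ∑ a₁, ∑ a₂, π₁ s a₁ * |π₂ s a₂ - π₂' s a₂| * (M.P s a₁ a₂ s' : ℝ) := by
        gcongr with s' _
        refine (Finset.abs_sum_le_sum_abs _ _).trans ?_
        gcongr with a₁ _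
        refine (Finset.abs_sum_le_sum_abs _ _).trans ?_
        gcongr with a₂ _
        rw [abs_mul, abs_mul, abs_of_nonneg (π₁.nonneg _ _), abs_of_nonneg (hP0 _ _ _)]
    _ = ∑ a, |π₂ s a - π₂' s a| := by
        rw [Finset.sum_comm]
        simp_rw [Finset.sum_comm (s := Finset.univ (α := Fin N)), ← Finset.mul_sum, hP, mul_one,
          ← Finset.mul_sum, ← Finset.sum_mul, Policy.sum_eq_one, one_mul]

/-- The influence is at most `1`, so it equals `1` as soon as some pair of policies attains this
value. -/
theorem influence₂_eq_one (π₁ : Policy ℝ N k₁) (π₂ π₂' : Policy ℝ N k₂) (hne : π₂ ≠ π₂')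
    (h : rowSumNorm (fun s a => π₂ s a - π₂' s a) ≤
      rowSumNorm fun s s' => M.kernel π₁ π₂ s s' - M.kernel π₁ π₂' s s') :
    M.influence₂ = 1 := by
  have hle (x : {x : Policy ℝ N k₁ × Policy ℝ N k₂ × Policy ℝ N k₂ // x.2.1 ≠ x.2.2}) :
      rowSumNorm (fun s s' => M.kernel x.1.1 x.1.2.1 s s' - M.kernel x.1.1 x.1.2.2 s s') /
        rowSumNorm (fun s a => x.1.2.1 s a - x.1.2.2 s a) ≤ 1 :=
    div_le_one_of_le₀ (M.rowSumNorm_kernel_sub_le _ _ _) (rowSumNorm_nonneg _)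
  refine le_antisymm (Real.iSup_le hle zero_le_one) ?_
  refine le_ciSup_of_le ⟨1, by rintro _ ⟨x, rfl⟩; exact hle x⟩ ⟨(π₁, π₂, π₂'), hne⟩ ?_
  have hpos : 0 < rowSumNorm fun s a => π₂ s a - π₂' s a := by
    obtain ⟨s, hs⟩ := Function.ne_iff.1 hne
    obtain ⟨a, ha⟩ : ∃ a, π₂ s a ≠ π₂' s a := by
      by_contra! hcon
      exact hs (Subtype.ext (funext hcon))
    refine lt_of_lt_of_le ?_ (le_rowSumNorm _ s)
    exact Finset.sum_pos' (fun _ _ => abs_nonneg _)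
      ⟨a, Finset.mem_univ _, abs_pos.2 (sub_ne_zero.2 ha)⟩
  exact (one_le_div hpos).2 h

/-- Doeblin's criterion: a stochastic matrix all of whose rows dominate a common vector of mass `δ`
contracts the ℓ¹-distance of distributions by the factor `1 - δ`. -/
theorem sum_abs_vecMul_sub_le {K : Matrix (Fin N) (Fin N) ℝ} (hK : ∀ i, ∑ j, K i j = 1)
    {ν : Fin N → ℝ} (hν : ∀ i j, ν j ≤ K i j) {d d' : Fin N → ℝ} (hd : ∑ s, d s = ∑ s, d' s) :
    ∑ s, |(d ᵥ* K) s - (d' ᵥ* K) s| ≤ (1 - ∑ j, ν j) * ∑ s, |d s - d' s| := by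
  have key (j : Fin N) : (d ᵥ* K) j - (d' ᵥ* K) j = ∑ i, (d i - d' i) * (K i j - ν j) := by
    simp_rw [mul_sub, Finset.sum_sub_distrib, ← Finset.sum_mul, Finset.sum_sub_distrib, hd]
    simp [Matrix.vecMul, dotProduct, sub_mul]
  calc ∑ j, |(d ᵥ* K) j - (d' ᵥ* K) j| ≤ ∑ j, ∑ i, |d i - d' i| * (K i j - ν j) := by
        gcongr with j _
        rw [key]
        refine (Finset.abs_sum_le_sum_abs _ _).trans ?_
        gcongr with i _
        rw [abs_mul, abs_of_nonneg (sub_nonneg.2 (hν i j))]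
    _ = (1 - ∑ j, ν j) * ∑ s, |d s - d' s| := by
        rw [Finset.sum_comm]
        simp_rw [← Finset.mul_sum, Finset.sum_sub_distrib, hK, ← Finset.sum_mul]
        ring

theorem vecMul_kernel_mem (π₁ : Policy ℝ N k₁) (π₂ : Policy ℝ N k₂) {d : Fin N → ℝ}
    (hd : d ∈ stdSimplex ℝ (Fin N)) : d ᵥ* M.kernel π₁ π₂ ∈ stdSimplex ℝ (Fin N) := by
  refine ⟨fun s => ?_, ?_⟩
  · rw [Matrix.vecMul, dotProduct]
    refine Finset.sum_nonneg fun i _ => mul_nonneg (hd.1 i) (M.le_kernel fun a₁ a₂ => ?_)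
    exact_mod_cast M.P_nonneg i a₁ a₂ s
  · simp_rw [Matrix.vecMul, dotProduct]
    rw [Finset.sum_comm]
    simp_rw [← Finset.mul_sum, kernel_sum, mul_one]
    exact hd.2

theorem abs_le_sum_abs {d : Fin N → ℝ} (s : Fin N) : |d s| ≤ ∑ s, |d s| :=
  Finset.single_le_sum (f := fun s => |d s|) (fun _ _ => abs_nonneg _) (Finset.mem_univ s)

/-- An MDP with a mixing time has a stationary distribution under every pair of policies. -/
theorem HasMixingTime.exists_isStationary {M : TwoAgentMDP N k₁ k₂} {ω : ℝ}
    (h : M.HasMixingTime ω) (hN : 0 < N) (π₁ : Policy ℝ N k₁) (π₂ : Policy ℝ N k₂) :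
    ∃ d, M.IsStationary π₁ π₂ d := by
  set K := M.kernel π₁ π₂ with hKdef
  set r := Real.exp (-1 / ω) with hr
  have hr0 : 0 ≤ r := (Real.exp_pos _).le
  have hr1 : r < 1 := Real.exp_lt_one_iff.2 (div_neg_of_neg_of_pos (by norm_num) h.1)
  have hmem (d : Fin N → ℝ) (hd : d ∈ stdSimplex ℝ (Fin N)) (m : ℕ) :
      d ᵥ* K ^ m ∈ stdSimplex ℝ (Fin N) := by
    induction m with
    | zero => simpa using hd
    | succ m ih =>
      rw [pow_succ, ← Matrix.vecMul_vecMul]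
      exact M.vecMul_kernel_mem _ _ ih
  have hcontr (d d' : Fin N → ℝ) (hd : d ∈ stdSimplex ℝ (Fin N))
      (hd' : d' ∈ stdSimplex ℝ (Fin N)) (m : ℕ) :
      ∑ s, |(d ᵥ* K ^ m) s - (d' ᵥ* K ^ m) s| ≤ r ^ m * ∑ s, |d s - d' s| := by
    induction m with
    | zero => simp
    | succ m ih =>
      rw [pow_succ, ← Matrix.vecMul_vecMul, ← Matrix.vecMul_vecMul]
      refine (h.2 π₁ π₂ _ (hmem d hd m) _ (hmem d' hd' m)).trans ?_
      rw [pow_succ', mul_assoc]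
      gcongr
  have hdist (d d' : Fin N → ℝ) (hd : d ∈ stdSimplex ℝ (Fin N))
      (hd' : d' ∈ stdSimplex ℝ (Fin N)) (m : ℕ) :
      dist (d ᵥ* K ^ m) (d' ᵥ* K ^ m) ≤ (∑ s, |d s - d' s|) * r ^ m := by
    have h₀ := Finset.sum_nonneg (s := Finset.univ) fun (s : Fin N) _ => abs_nonneg (d s - d' s)
    refine (dist_pi_le_iff (by positivity)).2 fun s => ?_
    rw [Real.dist_eq, mul_comm]
    exact (abs_le_sum_abs (d := fun s => (d ᵥ* K ^ m) s - (d' ᵥ* K ^ m) s) s).trans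
      (hcontr d d' hd hd' m)
  -- The iterates of any initial distribution converge geometrically.
  have hd₀ : (Pi.single ⟨0, hN⟩ 1 : Fin N → ℝ) ∈ stdSimplex ℝ (Fin N) := single_mem_stdSimplex ℝ _
  set d₀ : Fin N → ℝ := Pi.single ⟨0, hN⟩ 1
  have hcauchy : CauchySeq fun m => d₀ ᵥ* K ^ m := by
    refine cauchySeq_of_le_geometric r (∑ s, |d₀ s - (d₀ ᵥ* K) s|) hr1 fun m => ?_
    rw [pow_succ', ← Matrix.vecMul_vecMul]
    exact hdist d₀ (d₀ ᵥ* K) hd₀ (M.vecMul_kernel_mem _ _ hd₀) m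
  obtain ⟨d, hd⟩ := cauchySeq_tendsto_of_complete hcauchy
  have hdmem : d ∈ stdSimplex ℝ (Fin N) :=
    (isClosed_stdSimplex ℝ (Fin N)).mem_of_tendsto hd (.of_forall (hmem d₀ hd₀))
  refine ⟨d, hdmem, fun d₁ hd₁ => ?_, ?_⟩
  · have h₁ : Filter.Tendsto (fun m => dist (d₁ ᵥ* K ^ m) (d₀ ᵥ* K ^ m)) Filter.atTop (𝓝 0) := by
      refine squeeze_zero (fun _ => dist_nonneg) (hdist d₁ d₀ hd₁ hd₀) ?_
      simpa using (tendsto_pow_atTop_nhds_zero_of_lt_one hr0 hr1).const_mul (∑ s, |d₁ s - d₀ s|)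
    exact (tendsto_iff_of_dist h₁).2 hd
  · have h₁ : Filter.Tendsto (fun m => d₀ ᵥ* K ^ (m + 1)) Filter.atTop (𝓝 (d ᵥ* K)) := by
      simp_rw [pow_succ, ← Matrix.vecMul_vecMul]
      exact ((continuous_id.matrix_vecMul continuous_const).tendsto d).comp hd
    exact tendsto_nhds_unique h₁ (hd.comp (Filter.tendsto_add_atTop_nat 1))

theorem HasMixingTime.isStationary_stationary {M : TwoAgentMDP N k₁ k₂} {ω : ℝ}
    (h : M.HasMixingTime ω) (hN : 0 < N) (π₁ : Policy ℝ N k₁) (π₂ : Policy ℝ N k₂) :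
    M.IsStationary π₁ π₂ (M.stationary π₁ π₂) := by
  have h' := h.exists_isStationary hN π₁ π₂
  rw [stationary, dif_pos h']
  exact h'.choose_spec

end TwoAgentMDP

end CollabMDP

/-! ### The parity MDP -/

namespace CollabMDP

/-- The state that follows state `s` of the parity MDP, unless the walk is restarted. State
`2 * i + b` with `i ≤ n` means that the parity of the first `i` selected coordinates is `b`; the
bit `f` says whether the first agent selects coordinate `i`, and `g` is the value of this
coordinate. From the last layer the walk returns to the state `0`. -/
def target (n s : ℕ) (f g : Bool) : ℕ :=
  if s < 2 * n then
    if f then if g then if s = 2 * (s / 2) then s + 3 else s + 1 else s + 2 else s + 2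
  else 0

/-- The transition probabilities of the parity MDP, multiplied by the number `2 * n + 3` of states.
State `1` is never entered. There the second agent alone decides between the successors `0` and
`2 * n + 2`, so that its influence is `1`. In all other states there is a probability
`1 / (2 * n + 3)` for a jump to each of these two states, so that the MDP mixes. -/
def weight (n s : ℕ) (f g : Bool) (s' : ℕ) : ℕ :=
  if s = 1 then (if s' = (if g then 2 * n + 2 else 0) then 2 * n + 3 else 0)
  else ((if s' = 0 then 1 else 0) + (if s' = 2 * n + 2 then 1 else 0)) +
    (if s' = target n s f g then 2 * n + 1 else 0)

theorem target_lt {n s : ℕ} (f g : Bool) : target n s f g < 2 * n + 3 := by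
  unfold target; split_ifs <;> omega

theorem sum_ite_val_eq {N : ℕ} {c : ℕ} (hc : c < N) {R : Type*} [AddCommMonoid R] (w : R) :
    ∑ s : Fin N, (if (s : ℕ) = c then w else 0) = w := by
  rw [Finset.sum_eq_single ⟨c, hc⟩]
  · simp
  · intro b _ hb
    rw [if_neg]
    exact fun h => hb (Fin.ext h)
  · simp

theorem sum_weight (n s : ℕ) (f g : Bool) :
    ∑ s' : Fin (2 * n + 3), weight n s f g s' = 2 * n + 3 := by
  unfold weight
  by_cases hs : s = 1
  · simp only [hs, if_true]
    exact sum_ite_val_eq (by split_ifs <;> omega) _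
  · simp only [hs, if_false, Finset.sum_add_distrib]
    rw [sum_ite_val_eq (by omega), sum_ite_val_eq (by omega), sum_ite_val_eq (target_lt f g)]
    omega

/-- The MDP that evaluates a parity function. The first agent plays a nonzero action to select a
coordinate; in the states `2 * i` and `2 * i + 1` with `i < n` the second agent plays a nonzero
action if coordinate `i` of the example is `1`, and in the states `2 * n` and `2 * n + 1` it
rewards the parities `0` and `1`, respectively, according to the label. -/
def parityMDP (n k₁ k₂ : ℕ) : TwoAgentMDP (2 * n + 3) k₁ k₂ where
  P s a₁ a₂ s' := (weight n s (decide ((a₁ : ℕ) ≠ 0)) (decide ((a₂ : ℕ) ≠ 0)) s' : ℚ) /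
    (2 * n + 3 : ℕ)
  r s _ a₂ := if (s : ℕ) = 2 * n + (decide ((a₂ : ℕ) ≠ 0)).toNat then 1 else 0
  P_nonneg _ _ _ _ := by positivity
  P_sum s a₁ a₂ := by
    rw [← Finset.sum_div, ← Nat.cast_sum, sum_weight]
    exact div_self (by positivity)
  r_nonneg _ _ _ := by split_ifs <;> norm_num
  r_le_one _ _ _ := by split_ifs <;> norm_num

/-- The deterministic policy that plays action `1` in state `s` if `z s` is set, and action `0`
otherwise. -/
def Policy.ofBits {N k : ℕ} (z : ℕ → Bool) : Policy ℚ N (k + 2) := fun s =>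
  ⟨Pi.single (if z s then 1 else 0) 1, single_mem_stdSimplex ℚ _⟩

theorem Policy.ofBits_apply {N k : ℕ} (z : ℕ → Bool) (s : Fin N) (a : Fin (k + 2)) :
    (Policy.ofBits z : Policy ℚ N (k + 2)) s a = if a = (if z s then 1 else 0) then 1 else 0 :=
  Pi.single_apply _ _ _

theorem Policy.sum_ofBits {N k : ℕ} (z : ℕ → Bool) (s : Fin N) (F : Fin (k + 2) → ℝ) :
    ∑ a, (Policy.ofBits z : Policy ℚ N (k + 2)).toReal s a * F a = F (if z s then 1 else 0) := by
  have h (a) : (Policy.ofBits z : Policy ℚ N (k + 2)).toReal s a =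
      if a = (if z s then 1 else 0) then 1 else 0 := by
    rw [Policy.toReal_apply, Policy.ofBits_apply]
    split_ifs <;> simp
  simp_rw [h]
  simp

theorem decide_val_ne_zero {k : ℕ} (b : Bool) :
    decide (((if b then 1 else 0 : Fin (k + 2)) : ℕ) ≠ 0) = b := by
  cases b <;> simp

/-- Distributions on `k + 2` actions enter only through the probability of action `0`. -/
theorem sum_policy_mul {N k : ℕ} (π : Policy ℝ N (k + 2)) (s : Fin N) (F : Bool → ℝ) :
    ∑ a, π s a * F (decide ((a : ℕ) ≠ 0)) = π s 0 * F false + (1 - π s 0) * F true := by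
  have h := π.sum_eq_one s
  rw [Fin.sum_univ_succ] at h ⊢
  have h₁ (i : Fin (k + 1)) : decide ((i.succ : ℕ) ≠ 0) = true := by simp
  simp_rw [h₁, ← Finset.sum_mul]
  rw [← h, add_sub_cancel_left]
  rfl

section Mixing

variable {n k₁ k₂ : ℕ}

theorem parityMDP_P (s : Fin (2 * n + 3)) (a₁ : Fin k₁) (a₂ : Fin k₂) (s' : Fin (2 * n + 3)) :
    ((parityMDP n k₁ k₂).P s a₁ a₂ s' : ℝ) =
      (weight n s (decide ((a₁ : ℕ) ≠ 0)) (decide ((a₂ : ℕ) ≠ 0)) s' : ℝ) / (2 * n + 3) := by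
  simp [parityMDP]

/-- Every row of the transition matrix dominates the row of state `1`, divided by the number of
states. -/
theorem parityMDP_hasMixingTime (hn : 1 ≤ n) :
    (parityMDP n k₁ k₂).HasMixingTime (2 * n + 3) := by
  have hN : (0 : ℝ) < 2 * n + 3 := by positivity
  refine ⟨hN, fun π₁ π₂ d hd d' hd' => ?_⟩
  set K := (parityMDP n k₁ k₂).kernel π₁ π₂ with hK
  have h1 : 1 < 2 * n + 3 := by omega
  set e : Fin (2 * n + 3) := ⟨1, h1⟩ with he
  have hν (i j) : K e j / (2 * n + 3) ≤ K i j := by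
    rcases eq_or_ne i e with rfl | hi
    · refine div_le_self ((parityMDP n k₁ k₂).le_kernel fun a₁ a₂ => ?_) (by linarith)
      exact_mod_cast (parityMDP n k₁ k₂).P_nonneg _ _ _ _
    set c : ℕ := (if (j : ℕ) = 0 then 1 else 0) + (if (j : ℕ) = 2 * n + 2 then 1 else 0) with hc
    have h₁ : K e j ≤ c := by
      refine (parityMDP n k₁ k₂).kernel_le fun a₁ a₂ => ?_
      rw [parityMDP_P, div_le_iff₀ hN]
      have : weight n e (decide ((a₁ : ℕ) ≠ 0)) (decide ((a₂ : ℕ) ≠ 0)) j ≤ c * (2 * n + 3) := by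
        simp only [weight, he, if_true, hc]
        split_ifs <;> omega
      exact_mod_cast this
    have h₂ : (c : ℝ) / (2 * n + 3) ≤ K i j := by
      refine (parityMDP n k₁ k₂).le_kernel fun a₁ a₂ => ?_
      rw [parityMDP_P]
      gcongr
      have : (i : ℕ) ≠ 1 := fun h => hi (Fin.ext h)
      simp only [weight, this, if_false]
      exact Nat.le_add_right _ _
    exact (div_le_div_of_nonneg_right h₁ hN.le).trans h₂
  have h₁ := TwoAgentMDP.sum_abs_vecMul_sub_le ((parityMDP n k₁ k₂).kernel_sum π₁ π₂) hν
    (hd.2.trans hd'.2.symm)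
  refine h₁.trans ?_
  gcongr
  rw [← Finset.sum_div, TwoAgentMDP.kernel_sum]
  have := Real.add_one_le_exp (-1 / (2 * n + 3 : ℝ))
  rw [neg_div] at this ⊢
  linarith

/-- In state `1` the actions `0` and `1` of the second agent have different successors. -/
theorem parityMDP_influence₂ (hn : 1 ≤ n) : (parityMDP n (k₁ + 2) (k₂ + 2)).influence₂ = 1 := by
  have h1 : 1 < 2 * n + 3 := by omega
  set e : Fin (2 * n + 3) := ⟨1, h1⟩ with he
  have hN : (2 * n + 3 : ℝ) ≠ 0 := by positivity
  set π₁ : Policy ℝ (2 * n + 3) (k₁ + 2) := (Policy.ofBits fun _ => false).toReal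
  set π₂ : Policy ℝ (2 * n + 3) (k₂ + 2) := (Policy.ofBits fun _ => false).toReal
  set π₂' : Policy ℝ (2 * n + 3) (k₂ + 2) := (Policy.ofBits fun s => decide (s = 1)).toReal
  have hK (z : ℕ → Bool) (s') : (parityMDP n (k₁ + 2) (k₂ + 2)).kernel π₁
      (Policy.ofBits z).toReal e s' =
        if (s' : ℕ) = (if z 1 then 2 * n + 2 else 0) then 1 else 0 := by
    simp_rw [TwoAgentMDP.kernel, mul_assoc, ← Finset.mul_sum, Policy.sum_ofBits, π₁,
      Policy.sum_ofBits, parityMDP_P, decide_val_ne_zero, weight, he, if_true]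
    split_ifs <;> simp [hN]
  refine TwoAgentMDP.influence₂_eq_one _ π₁ π₂ π₂' (fun h => ?_) ?_
  · have := congrArg (fun π : Policy ℝ (2 * n + 3) (k₂ + 2) => π e 0) h
    simp [π₂, π₂', Policy.toReal_apply, Policy.ofBits_apply, he] at this
  · refine (rowSumNorm_le (c := 2) (by norm_num) fun s => ?_).trans
      (le_trans ?_ (le_rowSumNorm _ e))
    · calc ∑ a, |π₂ s a - π₂' s a| ≤ ∑ a, (π₂ s a + π₂' s a) := by
            gcongr with a _
            rw [abs_le]
            have := π₂.nonneg s a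
            have := π₂'.nonneg s a
            constructor <;> linarith
        _ = 2 := by rw [Finset.sum_add_distrib, Policy.sum_eq_one, Policy.sum_eq_one]; norm_num
    · simp_rw [π₂, π₂', hK]
      calc (2 : ℝ) = ∑ s : Fin (2 * n + 3), ((if (s : ℕ) = 0 then 1 else 0) +
            (if (s : ℕ) = 2 * n + 2 then 1 else 0)) := by
            rw [Finset.sum_add_distrib, sum_ite_val_eq (by omega), sum_ite_val_eq (by omega)]
            norm_num
        _ ≤ _ := by
            gcongr with s _
            have : (0 : ℕ) ≠ 2 * n + 2 := by omega
            by_cases h : (s : ℕ) = 0 <;> by_cases h' : (s : ℕ) = 2 * n + 2 <;>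
              simp_all

end Mixing

end CollabMDP

/-! ### The average reward of the parity MDP -/

namespace CollabMDP

/-- The probability that the parity after `i` layers is `1`, where `q s` is the probability that
the first agent does not select the coordinate that is read in state `s`. -/
def parityProb {K : Type*} [Ring K] (q : ℕ → K) (x : ℕ → Bool) : ℕ → K
  | 0 => 0
  | i + 1 => if x i then
      parityProb q x i * q (2 * i + 1) + (1 - parityProb q x i) * (1 - q (2 * i))
    else parityProb q x i

/-- The probability of action `0`, extended by `0` to all natural numbers. -/
def stayProb {K : Type} [Semiring K] [PartialOrder K] {N k : ℕ} (π : Policy K N (k + 2)) (s : ℕ) :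
    K :=
  if h : s < N then π ⟨s, h⟩ 0 else 0

/-- The stationary probability of the last layer of the parity MDP; it does not depend on the
policies. -/
noncomputable def lastLayerProb (n : ℕ) : ℝ :=
  let δ : ℝ := 1 / (2 * n + 3)
  (1 - 2 * δ) ^ n * ((δ + (1 - 2 * δ) * δ) / (1 - (1 - 2 * δ) ^ (n + 1)))

theorem inv_sq_le_lastLayerProb {n : ℕ} : 1 / (2 * n + 3 : ℝ) ^ 2 ≤ lastLayerProb n := by
  have hN : (0 : ℝ) < 2 * n + 3 := by positivity
  have hN3 : (3 : ℝ) ≤ 2 * n + 3 := by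
    have : (0 : ℝ) ≤ n := by positivity
    linarith
  unfold lastLayerProb
  set δ : ℝ := 1 / (2 * n + 3) with hδ
  have hδ0 : 0 < δ := by positivity
  have hδN : δ * (2 * n + 3) = 1 := by rw [hδ]; field_simp
  have hδ3 : 3 * δ ≤ 1 := by nlinarith
  have hb := one_add_mul_le_pow (a := -(2 * δ)) (by linarith) n
  rw [← sub_eq_add_neg] at hb
  have hp : (1 - 2 * δ) ^ (n + 1) < 1 := pow_lt_one₀ (by linarith) (by linarith) (by omega)
  have hp' : 0 ≤ (1 - 2 * δ) ^ (n + 1) := pow_nonneg (by linarith) _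
  have h₁ : δ ≤ (δ + (1 - 2 * δ) * δ) / (1 - (1 - 2 * δ) ^ (n + 1)) := by
    rw [le_div_iff₀ (by linarith)]
    nlinarith
  have h₂ : δ ≤ (1 - 2 * δ) ^ n := by nlinarith
  calc 1 / (2 * n + 3 : ℝ) ^ 2 = δ * δ := by rw [hδ]; field_simp
    _ ≤ _ := mul_le_mul h₂ h₁ hδ0.le (pow_nonneg (by linarith) _)

variable {n k₁ k₂ : ℕ}

/-- The transition probabilities of the parity MDP, as a function of numbers, when the second
agent plays deterministically. -/
noncomputable def weightMix (n : ℕ) (q : ℕ → ℝ) (z : ℕ → Bool) (s s' : ℕ) : ℝ :=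
  (q s * weight n s false (z s) s' + (1 - q s) * weight n s true (z s) s') / (2 * n + 3)

theorem parityMDP_kernel (π₁ : Policy ℝ (2 * n + 3) (k₁ + 2)) (z : ℕ → Bool)
    (s s' : Fin (2 * n + 3)) :
    (parityMDP n (k₁ + 2) (k₂ + 2)).kernel π₁ (Policy.ofBits z).toReal s s' =
      weightMix n (stayProb π₁) z s s' := by
  simp_rw [TwoAgentMDP.kernel, mul_assoc, ← Finset.mul_sum, Policy.sum_ofBits, parityMDP_P,
    decide_val_ne_zero]
  rw [sum_policy_mul π₁ s fun f => (weight n s f (z s) s' : ℝ) / (2 * n + 3), weightMix, stayProb,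
    dif_pos s.2]
  ring

/-- Outside of state `1` the transition probabilities consist of the restart and of the move to
the next layer. -/
theorem weightMix_of_ne_one (q : ℕ → ℝ) (z : ℕ → Bool) {s : ℕ} (hs : s ≠ 1) (s' : ℕ) :
    weightMix n q z s s' =
      (((if s' = 0 then 1 else 0) + (if s' = 2 * n + 2 then 1 else 0)) +
        (2 * n + 1) * (q s * (if s' = target n s false (z s) then 1 else 0) +
          (1 - q s) * (if s' = target n s true (z s) then 1 else 0))) / (2 * n + 3) := by
  simp only [weightMix, weight, hs, if_false]
  push_cast
  congr 1
  simp only [mul_ite, mul_one, mul_zero]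
  split_ifs <;> ring

/-- The stationary distribution of the parity MDP: in layer `i` its mass is distributed in the same
way as the parity of the coordinates that have been selected before. -/
theorem stationary_parityMDP (hn : 1 ≤ n) {q : ℕ → ℝ} {x z : ℕ → Bool}
    (hz₀ : ∀ i < n, z (2 * i) = x i) (hz₁ : ∀ i < n, 0 < i → z (2 * i + 1) = x i) {d : ℕ → ℝ}
    (hsum : ∑ s ∈ Finset.range (2 * n + 3), d s = 1)
    (hd : ∀ s' < 2 * n + 3, ∑ s ∈ Finset.range (2 * n + 3), d s * weightMix n q z s s' = d s') :
    d (2 * n) = lastLayerProb n * (1 - parityProb q x n) ∧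
      d (2 * n + 1) = lastLayerProb n * parityProb q x n := by
  have hN : (2 * n + 3 : ℝ) ≠ 0 := by positivity
  set δ : ℝ := 1 / (2 * n + 3) with hδ
  have hδ' : (2 * n + 1 : ℝ) / (2 * n + 3) = 1 - 2 * δ := by rw [hδ]; field_simp; ring
  -- State `1` is not entered.
  have hd1 : d 1 = 0 := by
    rw [← hd 1 (by omega)]
    refine Finset.sum_eq_zero fun s hs => ?_
    have hs' := Finset.mem_range.1 hs
    by_cases h1 : s = 1
    · subst h1
      have : 1 ≠ (if z 1 then 2 * n + 2 else 0) := by split_ifs <;> omega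
      simp [weightMix, weight, this]
    · have ht (f g) : 1 ≠ target n s f g := by unfold target; split_ifs <;> omega
      rw [weightMix_of_ne_one _ _ h1]
      simp [ht]
  have hd' (s' : ℕ) (hs' : s' < 2 * n + 3) :
      d s' = ∑ s ∈ Finset.range (2 * n + 3), d s *
        (((if s' = 0 then 1 else 0) + (if s' = 2 * n + 2 then 1 else 0)) * δ +
        (1 - 2 * δ) * (q s * (if s' = target n s false (z s) then 1 else 0) +
          (1 - q s) * (if s' = target n s true (z s) then 1 else 0))) := by
    rw [← hd s' hs']
    refine Finset.sum_congr rfl fun s _ => ?_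
    by_cases h1 : s = 1
    · rw [h1, hd1, zero_mul, zero_mul]
    · rw [weightMix_of_ne_one _ _ h1, ← hδ', hδ]
      ring
  -- The jump to `2 * n + 2` is the only way to enter this state.
  have hdv : d (2 * n + 2) = δ := by
    rw [hd' _ (by omega)]
    have ht (s f g) : 2 * n + 2 ≠ target n s f g := by unfold target; split_ifs <;> omega
    simp [ht, ← Finset.sum_mul, hsum]
  -- A layer is entered from the preceding one.
  have hstep (i : ℕ) (hi : i < n) (b : ℕ) (hb : b < 2) :
      d (2 * (i + 1) + b) = (1 - 2 * δ) *
        (d (2 * i) * (q (2 * i) * (if 2 * (i + 1) + b = target n (2 * i) false (z (2 * i))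
          then 1 else 0) + (1 - q (2 * i)) *
          (if 2 * (i + 1) + b = target n (2 * i) true (z (2 * i)) then 1 else 0)) +
        d (2 * i + 1) * (q (2 * i + 1) *
          (if 2 * (i + 1) + b = target n (2 * i + 1) false (z (2 * i + 1)) then 1 else 0) +
          (1 - q (2 * i + 1)) *
          (if 2 * (i + 1) + b = target n (2 * i + 1) true (z (2 * i + 1)) then 1 else 0))) := by
    rw [hd' _ (by omega), Finset.sum_eq_add (2 * i) (2 * i + 1) (by omega)]
    · rw [if_neg (by omega : 2 * (i + 1) + b ≠ 0), if_neg (by omega : 2 * (i + 1) + b ≠ 2 * n + 2)]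
      ring
    · intro s _ hs
      have ht (f g) : 2 * (i + 1) + b ≠ target n s f g := by unfold target; split_ifs <;> omega
      rw [if_neg (by omega : 2 * (i + 1) + b ≠ 0), if_neg (by omega : 2 * (i + 1) + b ≠ 2 * n + 2),
        if_neg (ht _ _), if_neg (ht _ _)]
      ring
    · intro h; exact absurd (Finset.mem_range.2 (by omega)) h
    · intro h; exact absurd (Finset.mem_range.2 (by omega)) h
  have hlayer (i : ℕ) (hi : i ≤ n) :
      d (2 * i) = (1 - 2 * δ) ^ i * d 0 * (1 - parityProb q x i) ∧
        d (2 * i + 1) = (1 - 2 * δ) ^ i * d 0 * parityProb q x i := by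
    induction i with
    | zero => simp [parityProb, hd1]
    | succ i ih =>
      obtain ⟨h₀, h₁⟩ := ih (by omega)
      have hz : d (2 * i + 1) = 0 ∨ z (2 * i + 1) = x i := by
        rcases Nat.eq_zero_or_pos i with rfl | hi0
        · exact .inl hd1
        · exact .inr (hz₁ i (by omega) hi0)
      have e₀ := hstep i (by omega) 0 (by omega)
      have e₁ := hstep i (by omega) 1 (by omega)
      have hlt₀ : 2 * i < 2 * n := by omega
      have hlt₁ : 2 * i + 1 < 2 * n := by omega
      have hev : 2 * i = 2 * (2 * i / 2) := by omega
      have hodd : ¬ 2 * i + 1 = 2 * ((2 * i + 1) / 2) := by omega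
      have a₁ : 2 * (i + 1) = 2 * i + 2 := by ring
      have a₂ : 2 * (i + 1) ≠ 2 * i + 3 := by omega
      have a₅ : 2 * (i + 1) + 1 = 2 * i + 3 := by ring
      have a₆ : 2 * (i + 1) + 1 ≠ 2 * i + 2 := by omega
      rw [hz₀ i (by omega)] at e₀ e₁
      have e (F G : Bool → ℝ) : d (2 * i + 1) * F (z (2 * i + 1)) = d (2 * i + 1) * F (x i) := by
        rcases hz with h | h <;> simp [h]
      rw [e (fun g => q (2 * i + 1) *
          (if 2 * (i + 1) + 0 = target n (2 * i + 1) false g then 1 else 0) +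
          (1 - q (2 * i + 1)) *
          (if 2 * (i + 1) + 0 = target n (2 * i + 1) true g then 1 else 0)) 0] at e₀
      rw [e (fun g => q (2 * i + 1) *
          (if 2 * (i + 1) + 1 = target n (2 * i + 1) false g then 1 else 0) +
          (1 - q (2 * i + 1)) *
          (if 2 * (i + 1) + 1 = target n (2 * i + 1) true g then 1 else 0)) 0] at e₁
      rw [add_zero] at e₀
      rw [e₀, e₁, h₀, h₁]
      cases hx : x i
      · constructor <;>
        · simp only [target, hlt₀, hlt₁, if_true, if_false, Bool.false_eq_true, a₁,
            parityProb, hx, ite_self]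
          simp
          try ring
      · constructor <;>
        · simp only [target, hlt₀, hlt₁, if_true, if_false, Bool.false_eq_true, parityProb, hx,
            if_pos hev, if_neg hodd, if_pos a₁, if_neg a₂, if_pos a₅, if_neg a₆]
          ring
  -- The mass of the first layer is found from the balance of state `0`.
  have hd0 : d 0 = δ + (1 - 2 * δ) * ((1 - 2 * δ) ^ n * d 0 + δ) := by
    have hle (s f g) (hs : s < 2 * n) : 0 ≠ target n s f g := by
      unfold target; rw [if_pos hs]; split_ifs <;> omega
    have hge (s f g) (hs : 2 * n ≤ s) : 0 = target n s f g := by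
      unfold target; rw [if_neg (by omega)]
    have h0 := hd' 0 (by omega)
    have hs₁ : ∀ s ∈ Finset.range (2 * n + 3), d s *
        (((if (0 : ℕ) = 0 then 1 else 0) + (if (0 : ℕ) = 2 * n + 2 then 1 else 0)) * δ +
        (1 - 2 * δ) * (q s * (if 0 = target n s false (z s) then 1 else 0) +
          (1 - q s) * (if 0 = target n s true (z s) then 1 else 0))) =
        d s * δ + (1 - 2 * δ) * (if 2 * n ≤ s then d s else 0) := by
      intro s _
      by_cases hs : 2 * n ≤ s
      · rw [if_pos hs, if_pos (hge s _ _ hs), if_pos (hge s _ _ hs)]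
        simp
        ring
      · rw [if_neg hs, if_neg (hle s _ _ (by omega)), if_neg (hle s _ _ (by omega))]
        simp
    rw [Finset.sum_congr rfl hs₁, Finset.sum_add_distrib, ← Finset.sum_mul, hsum, one_mul,
      ← Finset.mul_sum] at h0
    refine h0.trans ?_
    congr 2
    rw [Finset.sum_range_succ, Finset.sum_range_succ, Finset.sum_range_succ, Finset.sum_eq_zero,
      if_pos le_rfl, if_pos (by omega), if_pos (by omega), hdv, (hlayer n le_rfl).1,
      (hlayer n le_rfl).2]
    · ring
    · intro s hs
      rw [if_neg (by have := Finset.mem_range.1 hs; omega)]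
  have hN3 : (3 : ℝ) ≤ 2 * n + 3 := by
    have : (0 : ℝ) ≤ n := by positivity
    linarith
  have hδ0 : 0 < δ := by positivity
  have hδ3 : 3 * δ ≤ 1 := by rw [hδ, mul_one_div, div_le_one (by positivity)]; linarith
  have hp : (1 - 2 * δ) ^ (n + 1) < 1 := pow_lt_one₀ (by linarith) (by linarith) (by omega)
  have hlast : lastLayerProb n = (1 - 2 * δ) ^ n * d 0 := by
    have h0 : d 0 = (δ + (1 - 2 * δ) * δ) / (1 - (1 - 2 * δ) ^ (n + 1)) := by
      rw [eq_div_iff (by linarith)]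
      rw [pow_succ]
      linear_combination hd0
    rw [h0]
    rfl
  rw [hlast]
  exact hlayer n le_rfl

/-- The average reward is an affine function of the probability that the parity agrees with the
label. -/
theorem avgReward_parityMDP (hn : 1 ≤ n) (π₁ : Policy ℝ (2 * n + 3) (k₁ + 2)) {x z : ℕ → Bool}
    {y : Bool} (hz₀ : ∀ i < n, z (2 * i) = x i) (hz₁ : ∀ i < n, 0 < i → z (2 * i + 1) = x i)
    (hy₀ : z (2 * n) = y) (hy₁ : z (2 * n + 1) = y) :
    (parityMDP n (k₁ + 2) (k₂ + 2)).avgReward π₁ (Policy.ofBits z).toReal = lastLayerProb n *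
      (if y then parityProb (stayProb π₁) x n else 1 - parityProb (stayProb π₁) x n) := by
  have hst := (parityMDP_hasMixingTime (k₁ := k₁ + 2) (k₂ := k₂ + 2) hn).isStationary_stationary
    (by omega) π₁ (Policy.ofBits z).toReal
  unfold TwoAgentMDP.avgReward
  set d := (parityMDP n (k₁ + 2) (k₂ + 2)).stationary π₁ (Policy.ofBits z).toReal
  set D : ℕ → ℝ := fun s => if h : s < 2 * n + 3 then d ⟨s, h⟩ else 0
  have hD (s : Fin (2 * n + 3)) : D s = d s := dif_pos s.2
  obtain ⟨h₀, h₁⟩ := stationary_parityMDP (q := stayProb π₁) (d := D) hn hz₀ hz₁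
    (by rw [Finset.sum_range]; simp_rw [hD]; exact hst.1.2) (fun s' hs' => by
      rw [Finset.sum_range]
      have h := congrFun hst.2.2 ⟨s', hs'⟩
      simp_rw [Matrix.vecMul, dotProduct, parityMDP_kernel, ← hD] at h
      exact h)
  have hr (s : Fin (2 * n + 3)) : ∑ a₁, π₁ s a₁ * ∑ a₂,
      (Policy.ofBits z : Policy ℚ (2 * n + 3) (k₂ + 2)).toReal s a₂ *
        ((parityMDP n (k₁ + 2) (k₂ + 2)).r s a₁ a₂ : ℝ) =
      if (s : ℕ) = 2 * n + (z s).toNat then 1 else 0 := by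
    simp_rw [Policy.sum_ofBits, parityMDP, decide_val_ne_zero, ← Finset.sum_mul,
      Policy.sum_eq_one, one_mul]
    split_ifs <;> simp
  simp_rw [hr, ← hD]
  rw [← Finset.sum_range fun s => D s * if s = 2 * n + (z s).toNat then 1 else 0,
    Finset.sum_eq_single (2 * n + y.toNat)]
  · cases y
    · simpa [hy₀] using h₀
    · simpa [hy₁] using h₁
  · intro s hs hne
    rw [if_neg, mul_zero]
    intro h
    have : s = 2 * n ∨ s = 2 * n + 1 := by have := Bool.toNat_le (z s); omega
    rcases this with h' | h'
    · rw [h', hy₀] at h; exact hne (h'.trans h)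
    · rw [h', hy₁] at h; exact hne (h'.trans h)
  · intro h
    exact absurd (Finset.mem_range.2 (by have := Bool.toNat_le y; omega)) h

theorem parityProb_mem_Icc {K : Type*} [Field K] [LinearOrder K] [IsStrictOrderedRing K]
    {q : ℕ → K} (hq : ∀ s, 0 ≤ q s ∧ q s ≤ 1) (x : ℕ → Bool) (i : ℕ) :
    0 ≤ parityProb q x i ∧ parityProb q x i ≤ 1 := by
  induction i with
  | zero => simp [parityProb]
  | succ i ih =>
    obtain ⟨h₀, h₁⟩ := ih
    obtain ⟨a₀, a₁⟩ := hq (2 * i)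
    obtain ⟨b₀, b₁⟩ := hq (2 * i + 1)
    unfold parityProb
    split_ifs
    · constructor
      · have := mul_nonneg h₀ b₀
        have := mul_nonneg (sub_nonneg.2 h₁) (sub_nonneg.2 a₁)
        linarith
      · have := mul_le_mul_of_nonneg_left b₁ h₀
        have := mul_le_mul_of_nonneg_left (sub_le_self 1 a₀) (sub_nonneg.2 h₁)
        linarith
    · exact ⟨h₀, h₁⟩

theorem stayProb_mem_Icc {N k : ℕ} (π : Policy ℝ N (k + 2)) (s : ℕ) :
    0 ≤ stayProb π s ∧ stayProb π s ≤ 1 := by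
  unfold stayProb
  split_ifs with h
  · refine ⟨π.nonneg _ _, ?_⟩
    rw [← π.sum_eq_one ⟨s, h⟩]
    exact Finset.single_le_sum (fun a _ => π.nonneg _ a) (Finset.mem_univ _)
  · simp

/-- A first agent that selects the coordinates in `I` computes the parity function of `I`. -/
theorem parityProb_ofBits (I : Finset (Fin n)) (x : Fin n → Bool) {X : ℕ → Bool}
    (hX : ∀ i : Fin n, X i = x i) :
    parityProb (stayProb (Policy.ofBits (N := 2 * n + 3) (k := k₁)
        fun s => decide (∃ i ∈ I, (i : ℕ) = s / 2)).toReal) X n =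
      if parity I x then 1 else 0 := by
  set J : ℕ → Bool := fun j => decide (∃ i ∈ I, (i : ℕ) = j)
  have hq (s : ℕ) (hs : s < 2 * n) : stayProb (Policy.ofBits (N := 2 * n + 3) (k := k₁)
      fun s => decide (∃ i ∈ I, (i : ℕ) = s / 2)).toReal s = if J (s / 2) then 0 else 1 := by
    unfold stayProb
    rw [dif_pos (by omega), Policy.toReal_apply, Policy.ofBits_apply]
    simp only [J]
    by_cases h : ∃ i ∈ I, (i : ℕ) = s / 2 <;> simp [h]
  have key (m : ℕ) (hm : m ≤ n) : parityProb (stayProb (Policy.ofBits (N := 2 * n + 3) (k := k₁)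
      fun s => decide (∃ i ∈ I, (i : ℕ) = s / 2)).toReal) X m =
      if Odd ((Finset.range m).filter fun j => J j ∧ X j).card then 1 else 0 := by
    induction m with
    | zero => simp [parityProb]
    | succ m ih =>
      rw [parityProb, ih (by omega), hq _ (by omega), hq _ (by omega), Finset.range_add_one,
        Finset.filter_insert]
      have e₁ : (2 * m + 1) / 2 = m := by omega
      have e₂ : 2 * m / 2 = m := by omega
      rw [e₁, e₂]
      cases hx : X m
      · simp
      · cases hJ : J m
        · simp
        · simp only [if_true, and_self]
          rw [Finset.card_insert_of_notMem (by simp)]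
          simp only [Nat.odd_add_one]
          split_ifs <;> simp
  rw [key n le_rfl, parity]
  have : ((Finset.range n).filter fun j => J j ∧ X j).card =
      (I.filter fun i => x i = true).card := by
    symm
    refine Finset.card_bij (fun i _ => (i : ℕ)) ?_ (fun _ _ _ _ h => Fin.ext h) ?_
    · intro i hi
      rw [Finset.mem_filter] at hi ⊢
      exact ⟨Finset.mem_range.2 i.2, by simpa [J, Fin.val_inj] using hi.1, by rw [hX]; exact hi.2⟩
    · intro j hj
      rw [Finset.mem_filter] at hj
      obtain ⟨-, hJ, hx⟩ := hj
      obtain ⟨i, hi, rfl⟩ := of_decide_eq_true hJ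
      exact ⟨i, Finset.mem_filter.2 ⟨hi, by rw [← hX]; exact hx⟩, rfl⟩
  rw [this]
  simp

end CollabMDP

/-! ### Computing the input of the first agent -/

namespace CollabMDP

theorem Val.ofRat_eq_of_coprime {a b : ℕ} (hb : b ≠ 0) (h : a.Coprime b) :
    Val.ofRat ((a : ℚ) / b) = .pair (.num a) (.num b) := by
  have h₁ := Rat.num_div_eq_of_coprime (a := a) (b := b) (by omega) (by simpa using h)
  have h₂ := Rat.den_div_eq_of_coprime (a := a) (b := b) (by omega) (by simpa using h)
  simp only [Int.cast_natCast] at h₁ h₂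
  rw [Val.ofRat, h₁]
  congr 2
  exact_mod_cast h₂

theorem weight_cases (n s : ℕ) (f g : Bool) (s' : ℕ) :
    weight n s f g s' = 0 ∨ weight n s f g s' = 2 * n + 3 ∨
      (weight n s f g s').Coprime (2 * n + 3) := by
  have h₁ : (2 * n + 1).Coprime (2 * n + 3) := by
    rw [show 2 * n + 3 = 2 * n + 1 + 2 by ring, Nat.coprime_self_add_right,
      Nat.coprime_two_right]
    exact odd_two_mul_add_one n
  have h₂ : (1 + (2 * n + 1)).Coprime (2 * n + 3) := by
    rw [show 2 * n + 3 = 1 + (2 * n + 1) + 1 by ring, Nat.coprime_self_add_right]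
    exact Nat.coprime_one_right _
  have h₃ : target n s f g ≠ 2 * n + 2 := by unfold target; split_ifs <;> omega
  by_cases hs : s = 1
  · simp only [weight, hs, if_true]
    split_ifs <;> simp
  · simp only [weight, hs, if_false]
    by_cases a : s' = 0
    · rw [if_pos a, if_neg (by omega)]
      split_ifs
      · exact .inr (.inr h₂)
      · simp
    · by_cases b : s' = 2 * n + 2
      · rw [if_neg a, if_pos b, if_neg (by omega)]
        simp
      · rw [if_neg a, if_neg b]
        split_ifs
        · exact .inr (.inr (by simpa using h₁))
        · simp

theorem ofRat_weight (n s : ℕ) (f g : Bool) (s' : ℕ) :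
    Val.ofRat ((weight n s f g s' : ℚ) / (2 * n + 3 : ℕ)) =
      if weight n s f g s' = 0 then .pair (.num 0) (.num 1)
      else if weight n s f g s' = 2 * n + 3 then .pair (.num 1) (.num 1)
      else .pair (.num (weight n s f g s')) (.num (2 * n + 3)) := by
  split_ifs with h₀ h₁
  · rw [h₀]
    simp [Val.ofRat]
  · rw [h₁, div_self (by positivity)]
    simp [Val.ofRat]
  · refine Val.ofRat_eq_of_coprime (by omega) ?_
    rcases weight_cases n s f g s' with h | h | h
    · exact absurd h h₀
    · exact absurd h h₁
    · exact h

namespace PolyTime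

variable {n s f g s' : Val → ℕ}

theorem target (hn : PolyTime fun v => .num (n v)) (hs : PolyTime fun v => .num (s v))
    (hf : PolyTime fun v => .num (f v)) (hg : PolyTime fun v => .num (g v)) :
    PolyTime fun v => .num
      (CollabMDP.target (n v) (s v) (decide (f v ≠ 0)) (decide (g v ≠ 0))) := by
  have h := num_ite_lt hs (mul (const (.num 2)) hn)
    (num_ite_eq hf (const (.num 0)) (add hs (const (.num 2)))
      (num_ite_eq hg (const (.num 0)) (add hs (const (.num 2)))
        (num_ite_eq hs (mul (const (.num 2)) (div hs (const (.num 2))))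
          (add hs (const (.num 3))) (add hs (const (.num 1)))))) (const (.num 0))
  convert h using 3 with v
  unfold CollabMDP.target
  by_cases h₁ : f v = 0 <;> by_cases h₂ : g v = 0 <;> simp [h₁, h₂]

theorem weight (hn : PolyTime fun v => .num (n v)) (hs : PolyTime fun v => .num (s v))
    (hf : PolyTime fun v => .num (f v)) (hg : PolyTime fun v => .num (g v))
    (hs' : PolyTime fun v => .num (s' v)) : PolyTime fun v => .num
      (CollabMDP.weight (n v) (s v) (decide (f v ≠ 0)) (decide (g v ≠ 0)) (s' v)) := by
  have hN : PolyTime fun v => .num (2 * n v + 3) :=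
    add (mul (const (.num 2)) hn) (const (.num 3))
  have hv : PolyTime fun v => .num (2 * n v + 2) :=
    add (mul (const (.num 2)) hn) (const (.num 2))
  have hL : PolyTime fun v => .num (2 * n v + 1) :=
    add (mul (const (.num 2)) hn) (const (.num 1))
  have h := num_ite_eq hs (const (.num 1))
    (num_ite_eq hs' (num_ite_eq hg (const (.num 0)) (const (.num 0)) hv) hN (const (.num 0)))
    (add (add (num_ite_eq hs' (const (.num 0)) (const (.num 1)) (const (.num 0)))
      (num_ite_eq hs' hv (const (.num 1)) (const (.num 0))))
      (num_ite_eq hs' (target hn hs hf hg) hL (const (.num 0))))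
  convert h using 3 with v
  unfold CollabMDP.weight
  by_cases h₂ : g v = 0 <;> simp [h₂]

theorem ofRat_weight (hn : PolyTime fun v => .num (n v)) (hs : PolyTime fun v => .num (s v))
    (hf : PolyTime fun v => .num (f v)) (hg : PolyTime fun v => .num (g v))
    (hs' : PolyTime fun v => .num (s' v)) : PolyTime fun v => Val.ofRat
      ((CollabMDP.weight (n v) (s v) (decide (f v ≠ 0)) (decide (g v ≠ 0)) (s' v) : ℚ) /
        (2 * n v + 3 : ℕ)) := by
  simp_rw [CollabMDP.ofRat_weight]
  exact ite_eq (weight hn hs hf hg hs') (const _) (const _)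
    (ite_eq (weight hn hs hf hg hs') (add (mul (const (.num 2)) hn) (const (.num 3))) (const _)
      ((weight hn hs hf hg hs').pair (add (mul (const (.num 2)) hn) (const (.num 3)))))

theorem states {x : Val → Val} (hx : PolyTime x) :
    PolyTime fun v => .ofList ((List.range (2 * (x v).toList.length + 3)).map .num) := by
  have h := (double_append hx (const (.ofList [.num 0, .num 0, .num 0]))).range
  convert h using 5 with v
  induction (x v).toList with
  | nil => rfl
  | cons a l ih => simp only [List.length_cons, List.foldr_cons, Val.toList] at ih ⊢; omega

theorem encode_parityMDP {x : Val → Val} (hx : PolyTime x) (k₁ k₂ : ℕ) :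
    PolyTime fun v => (parityMDP (x v).toList.length k₁ k₂).encode := by
  refine pair ?_ ?_
  · refine ofFn (m := fun v => 2 * (x v).toList.length + 3)
      (g := fun v s => Val.ofFn fun a₁ : Fin k₁ => Val.ofFn fun a₂ : Fin k₂ =>
        Val.ofFn fun s' : Fin (2 * (x v).toList.length + 3) => Val.ofRat
          ((CollabMDP.weight (x v).toList.length s (decide ((a₁ : ℕ) ≠ 0))
            (decide ((a₂ : ℕ) ≠ 0)) s' : ℚ) / (2 * (x v).toList.length + 3 : ℕ))) (states hx) ?_
    refine ofFn (m := fun _ => k₁)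
      (g := fun w a₁ => Val.ofFn fun a₂ : Fin k₂ =>
        Val.ofFn fun s' : Fin (2 * (x w.fst).toList.length + 3) => Val.ofRat
          ((CollabMDP.weight (x w.fst).toList.length w.snd.toNat (decide (a₁ ≠ 0))
            (decide ((a₂ : ℕ) ≠ 0)) s' : ℚ) / (2 * (x w.fst).toList.length + 3 : ℕ)))
      (const _) ?_
    refine ofFn (m := fun _ => k₂)
      (g := fun w a₂ =>
        Val.ofFn fun s' : Fin (2 * (x w.fst.fst).toList.length + 3) => Val.ofRat
          ((CollabMDP.weight (x w.fst.fst).toList.length w.fst.snd.toNat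
            (decide (w.snd.toNat ≠ 0)) (decide (a₂ ≠ 0)) s' : ℚ) /
              (2 * (x w.fst.fst).toList.length + 3 : ℕ)))
      (const _) ?_
    refine ofFn (m := fun w => 2 * (x w.fst.fst.fst).toList.length + 3)
      (g := fun w s' => Val.ofRat
          ((CollabMDP.weight (x w.fst.fst.fst).toList.length w.fst.fst.snd.toNat
            (decide (w.fst.snd.toNat ≠ 0)) (decide (w.snd.toNat ≠ 0)) s' : ℚ) /
              (2 * (x w.fst.fst.fst).toList.length + 3 : ℕ)))
      (states (hx.comp id.fst.fst.fst)) ?_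
    exact ofRat_weight (hx.comp id.fst.fst.fst.fst).length id.fst.fst.fst.snd.toNat
      id.fst.fst.snd.toNat id.fst.snd.toNat id.snd.toNat
  · refine ofFn (m := fun v => 2 * (x v).toList.length + 3)
      (g := fun v s => Val.ofFn fun _ : Fin k₁ => Val.ofFn fun a₂ : Fin k₂ => Val.ofRat
        (if s = 2 * (x v).toList.length + (decide ((a₂ : ℕ) ≠ 0)).toNat then 1 else 0))
      (states hx) ?_
    refine ofFn (m := fun _ => k₁)
      (g := fun w _ => Val.ofFn fun a₂ : Fin k₂ => Val.ofRat
        (if w.snd.toNat = 2 * (x w.fst).toList.length + (decide ((a₂ : ℕ) ≠ 0)).toNat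
          then 1 else 0)) (const _) ?_
    refine ofFn (m := fun _ => k₂)
      (g := fun w a₂ => Val.ofRat
        (if w.fst.snd.toNat = 2 * (x w.fst.fst).toList.length + (decide (a₂ ≠ 0)).toNat
          then 1 else 0)) (const _) ?_
    have hlen := (hx.comp id.fst.fst.fst).length
    have h := ite_eq id.fst.fst.snd.toNat
      (add (mul (const (.num 2)) hlen)
        (num_ite_eq id.snd.toNat (const (.num 0)) (const (.num 0)) (const (.num 1))))
      (const (.ofRat 1)) (const (.ofRat 0))
    convert h using 2 with w
    by_cases h₂ : w.snd.toNat = 0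
    · simp only [h₂, ne_eq, not_true_eq_false, decide_false, Bool.toNat_false, if_true,
        apply_ite Val.ofRat]
    · simp only [h₂, ne_eq, not_false_eq_true, decide_true, Bool.toNat_true, if_false,
        apply_ite Val.ofRat]

end PolyTime

/-- The actions of the second agent that stand for the labelled example `(x, y)`. -/
def exampleBits (n : ℕ) (x : ℕ → Bool) (y : Bool) (s : ℕ) : Bool :=
  if s < 2 * n then x (s / 2) else if s < 2 * n + 2 then y else false

/-- The encoding of the distribution on actions that is concentrated in action `1` or `0`. -/
def actionRow (k : ℕ) (b : Bool) : Val :=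
  .ofFn fun a : Fin (k + 2) => .ofRat (if a = (if b then 1 else 0) then 1 else 0)

/-- The encoding of the policy of the second agent, computed from the encoding of a labelled
example. -/
def policyOfExample (k : ℕ) (v : Val) : Val :=
  .ofList ((v.fst.toList.foldr (fun a acc => Val.pair a (.pair a acc))
    (.ofList [v.snd, v.snd, .num 0])).toList.map
      fun z => if z.toNat = 0 then actionRow k false else actionRow k true)

theorem PolyTime.policyOfExample (k : ℕ) : PolyTime (policyOfExample k) :=
  map (g := fun _ z => if z.toNat = 0 then actionRow k false else actionRow k true)
    (double_append id.fst (id.snd.pair (id.snd.pair (const _))))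
    (ite_eq id.snd.toNat (const (.num 0)) (const _) (const _))

theorem toNat_ofBool (b : Bool) : (Val.ofBool b).toNat = b.toNat := rfl

theorem policyOfExample_eq (n k : ℕ) (x : ℕ → Bool) (y : Bool) :
    policyOfExample k (.pair (.ofFn fun i : Fin n => .ofBool (x i)) (.ofBool y)) =
      (Policy.ofBits (exampleBits n x y) : Policy ℚ (2 * n + 3) (k + 2)).encode := by
  have hrow (b : Bool) :
      (if (Val.ofBool b).toNat = 0 then actionRow k false else actionRow k true) =
        actionRow k b := by cases b <;> simp [toNat_ofBool]
  have hdup (m : ℕ) (tl : List Val) : ((List.range m).map fun i => Val.ofBool (x i)).foldr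
      (fun a acc => Val.pair a (.pair a acc)) (.ofList tl) =
        .ofList (((List.range (2 * m)).map fun s => .ofBool (x (s / 2))) ++ tl) := by
    induction m generalizing tl with
    | zero => simp
    | succ m ih =>
      have h := ih (.ofBool (x m) :: .ofBool (x m) :: tl)
      simp only [Val.ofList] at h
      simp only [List.range_succ, List.map_append, List.foldr_append, List.map_cons, List.map_nil,
        List.foldr_cons, List.foldr_nil, h, show 2 * (m + 1) = 2 * m + 1 + 1 by ring,
        show (2 * m + 1) / 2 = m by omega, show 2 * m / 2 = m by omega]
      simp
  have h₁ : (Policy.ofBits (exampleBits n x y) : Policy ℚ (2 * n + 3) (k + 2)).encode =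
      .ofList ((List.range (2 * n + 3)).map fun s => actionRow k (exampleBits n x y s)) := by
    rw [← Val.ofFn_eq_map_range, Policy.encode]
    simp_rw [Policy.ofBits_apply]
    rfl
  rw [h₁, policyOfExample, Val.fst_pair, Val.snd_pair,
    Val.ofFn_eq_map_range fun i => .ofBool (x i), Val.toList_ofList, hdup, Val.toList_ofList]
  congr 1
  have h₂ : ((List.range (2 * n)).map fun s => Val.ofBool (x (s / 2))) ++
      [.ofBool y, .ofBool y, .num 0] =
      (List.range (2 * n + 3)).map fun s => .ofBool (exampleBits n x y s) := by
    simp only [List.range_succ, List.map_append, List.append_assoc, List.map_cons, List.map_nil]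
    congr 1
    · refine List.map_congr_left fun s hs => ?_
      rw [exampleBits, if_pos (List.mem_range.1 hs)]
    · simp [exampleBits, Val.ofBool]
  rw [h₂, List.map_map]
  exact List.map_congr_left fun s _ => hrow _

end CollabMDP

/-! ### Random thresholds and the simulation of a policy -/

namespace CollabMDP

/-- The state consists of a counter, a number `U` with an upper bound `W`, and a list of bits. While
the counter is positive, a bit is moved from the list to the front of the binary expansion
of `U`. -/
def takeBit (acc : Val) : Val :=
  if acc.fst.toNat = 0 then acc
  else .pair (.num (acc.fst.toNat - 1)) (.pair (.pair
    (.num (if acc.snd.snd.fst.toNat = 0 then acc.snd.fst.fst.toNat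
      else acc.snd.fst.fst.toNat + acc.snd.fst.snd.toNat))
    (.num (2 * acc.snd.fst.snd.toNat))) acc.snd.snd.snd)

theorem PolyTime.takeBit : PolyTime takeBit :=
  ite_eq id.fst.toNat (const (.num 0)) id
    ((sub id.fst.toNat (const (.num 1))).pair (((num_ite_eq id.snd.snd.fst.toNat (const (.num 0))
      id.snd.fst.fst.toNat (add id.snd.fst.fst.toNat id.snd.fst.snd.toNat)).pair
      (mul (const (.num 2)) id.snd.fst.snd.toNat)).pair id.snd.snd.snd))

/-- The first bits of a list, as many as a given number says, are combined to a number `U`; the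
result consists of `U`, its upper bound, and the remaining bits. The length of the list bounds the
number of repetitions. -/
def splitBits (m : ℕ) (l : Val) : Val :=
  (l.toList.foldl (fun acc _ => takeBit acc)
    (.pair (.num m) (.pair (.pair (.num 0) (.num 1)) l))).snd

theorem PolyTime.splitBits {m l : Val → Val} (hm : PolyTime m) (hl : PolyTime l) :
    PolyTime fun v => splitBits (m v).toNat (l v) := by
  refine (foldl (g := fun _ acc _ => CollabMDP.takeBit acc) hl
    (hm.toNat.pair ((const (.pair (.num 0) (.num 1))).pair hl))
    (takeBit.comp id.snd.fst) ?_).snd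
  obtain ⟨L, hL⟩ := hl.size_le
  obtain ⟨M, hM⟩ := hm.size_le
  have key (v : Val) (l₁ : List Val) : ∃ (c U W : ℕ) (r : Val),
      l₁.foldl (fun acc _ => CollabMDP.takeBit acc)
        (.pair (.num (m v).toNat) (.pair (.pair (.num 0) (.num 1)) (l v))) =
        .pair (.num c) (.pair (.pair (.num U) (.num W)) r) ∧ c ≤ (m v).toNat ∧
        U < 2 ^ l₁.length ∧ W ≤ 2 ^ l₁.length ∧ r.size ≤ (l v).size := by
    induction l₁ using List.reverseRecOn with
    | nil => exact ⟨_, _, _, _, rfl, le_rfl, by simp, by simp, le_rfl⟩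
    | append_singleton l₁ a ih =>
      obtain ⟨c, U, W, r, h, hc, hU, hW, hr⟩ := ih
      rw [List.foldl_append, h]
      simp only [List.foldl_cons, List.foldl_nil, CollabMDP.takeBit, Val.fst_pair, Val.snd_pair,
        Val.toNat_num, List.length_append, List.length_cons, List.length_nil, pow_succ,
        zero_add]
      by_cases hc0 : c = 0
      · exact ⟨_, _, _, _, if_pos hc0, hc, by omega, by omega, hr⟩
      · have hU' : (if r.fst.toNat = 0 then U else U + W) < 2 ^ l₁.length * 2 := by
          split_ifs <;> omega
        exact ⟨_, _, _, _, if_neg hc0, by omega, hU', by omega, r.size_snd_le.trans hr⟩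
  refine ⟨M + 3 * L + 8, fun v l₁ hl₁ => ?_⟩
  obtain ⟨c, U, W, r, h, hc, hU, hW, hr⟩ := key v l₁
  rw [h]
  have h₁ : l₁.length ≤ L.eval v.size :=
    hl₁.length_le.trans ((l v).length_toList_le.trans (hL v))
  have h₂ := (Nat.size_le_size hc).trans ((m v).size_toNat_le.trans (hM v))
  have h₃ : Nat.size U ≤ l₁.length := Nat.size_le.2 hU
  have h₄ : Nat.size W ≤ l₁.length + 1 := Nat.size_le.2 (by rw [pow_succ]; omega)
  have h₅ := hL v
  simp only [Val.size, Polynomial.eval_add, Polynomial.eval_mul, Polynomial.eval_ofNat]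
  omega

/-- The number with given binary digits. -/
def bitsValue {m : ℕ} (σ : Fin m → Bool) : ℕ := ∑ i, (σ i).toNat * 2 ^ (i : ℕ)

theorem splitBits_eq {m l : ℕ} (σ : Fin m → Bool) (τ : Fin l → Bool) :
    splitBits m (.ofFn fun i => .ofBool (Fin.append σ τ i)) =
      .pair (.pair (.num (bitsValue σ)) (.num (2 ^ m))) (.ofFn fun i => .ofBool (τ i)) := by
  have hstep (L : List Val) (acc : Val) :
      L.foldl (fun acc _ => takeBit acc) acc = takeBit^[L.length] acc := by
    induction L generalizing acc with
    | nil => rfl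
    | cons a L ih => simp [ih]
  have hrest (k : ℕ) (w : Val) : takeBit^[k] (.pair (.num 0) w) = .pair (.num 0) w := by
    induction k with
    | zero => rfl
    | succ k ih => rw [Function.iterate_succ_apply, takeBit, if_pos (by rfl), ih]
  have key (m : ℕ) (σ : Fin m → Bool) (U W k : ℕ) (r : List Val) :
      takeBit^[m + k] (.pair (.num m) (.pair (.pair (.num U) (.num W))
        (.ofList ((List.ofFn fun i => .ofBool (σ i)) ++ r)))) =
      .pair (.num 0)
        (.pair (.pair (.num (U + W * bitsValue σ)) (.num (W * 2 ^ m))) (.ofList r)) := by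
    induction m generalizing U W with
    | zero => simp [hrest, bitsValue]
    | succ m ih =>
      have h := ih (fun i => σ i.succ) (if (σ 0).toNat = 0 then U else U + W) (2 * W)
      rw [show m + 1 + k = (m + k) + 1 by ring, Function.iterate_succ_apply, takeBit]
      simp only [Val.fst_pair, Val.snd_pair, Val.toNat_num, Nat.add_sub_cancel, List.ofFn_succ,
        List.cons_append, Val.ofList, Nat.add_eq_zero_iff, one_ne_zero, and_false, if_false,
        toNat_ofBool]
      rw [h]
      congr 3
      · congr 1
        simp only [bitsValue, Fin.sum_univ_succ, Fin.val_zero, pow_zero, mul_one, Fin.val_succ,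
          pow_succ]
        rw [mul_add, Finset.mul_sum, Finset.mul_sum]
        have (i : Fin m) : 2 * W * ((σ i.succ).toNat * 2 ^ (i : ℕ)) =
          W * ((σ i.succ).toNat * (2 ^ (i : ℕ) * 2)) := by ring
        simp_rw [this]
        cases σ 0 <;> simp [add_assoc]
      · congr 1
        ring
  have happ : (List.ofFn fun i => Val.ofBool (Fin.append σ τ i)) =
      (List.ofFn fun i => .ofBool (σ i)) ++ List.ofFn fun i => .ofBool (τ i) := by
    rw [← List.ofFn_fin_append]
    congr 1
    funext i
    refine Fin.addCases (fun i => ?_) (fun i => ?_) i <;> simp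
  rw [splitBits, hstep, Val.ofFn, Val.toList_ofList, List.length_ofFn, happ, key]
  simp [Val.ofFn]

/-- Numerator of a fraction; a fraction with denominator `0` stands for `0`. -/
def Val.ratNum (v : Val) : ℕ := if v.snd.toNat = 0 then 0 else v.fst.toNat

/-- Denominator of a fraction, or `1` if it is `0`. -/
def Val.ratDen (v : Val) : ℕ := if v.snd.toNat = 0 then 1 else v.snd.toNat

theorem Val.ratDen_pos (v : Val) : 0 < v.ratDen := by
  unfold ratDen; split_ifs <;> omega

theorem Val.ratNum_div_ratDen (v : Val) : (v.ratNum : ℚ) / v.ratDen = v.toRat := by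
  unfold ratNum ratDen toRat
  split_ifs with h <;> simp [h]

theorem Val.ratNum_lt (v : Val) : v.ratNum < 2 ^ v.size := by
  unfold ratNum
  split_ifs
  · positivity
  · exact Nat.size_le.1 (v.fst.size_toNat_le.trans v.size_fst_le)

theorem Val.ratDen_lt (v : Val) : v.ratDen < 2 ^ v.size := by
  unfold ratDen
  split_ifs
  · exact Nat.one_lt_two_pow v.size_pos.ne'
  · exact Nat.size_le.1 (v.snd.size_toNat_le.trans v.size_snd_le)

/-- One layer of the parity MDP. The state consists of the rows of the policy for the remaining
layers and of two numbers that are proportional to the probabilities of the parities `0` and `1`;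
`b` is the value of the coordinate. -/
def simulateLayer (acc b : Val) : Val :=
  .pair acc.fst.snd.snd
    (if b.toNat = 0 then acc.snd else .pair
      (.num (acc.snd.fst.toNat * (acc.fst.fst.fst.ratNum * acc.fst.snd.fst.fst.ratDen) +
        acc.snd.snd.toNat * ((acc.fst.snd.fst.fst.ratDen - acc.fst.snd.fst.fst.ratNum) *
          acc.fst.fst.fst.ratDen)))
      (.num (acc.snd.fst.toNat * ((acc.fst.fst.fst.ratDen - acc.fst.fst.fst.ratNum) *
          acc.fst.snd.fst.fst.ratDen) +
        acc.snd.snd.toNat * (acc.fst.snd.fst.fst.ratNum * acc.fst.fst.fst.ratDen))))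

theorem PolyTime.ratNum {f : Val → Val} (hf : PolyTime f) : PolyTime fun v => .num (f v).ratNum :=
  num_ite_eq hf.snd.toNat (const (.num 0)) (const (.num 0)) hf.fst.toNat

theorem PolyTime.ratDen {f : Val → Val} (hf : PolyTime f) : PolyTime fun v => .num (f v).ratDen :=
  num_ite_eq hf.snd.toNat (const (.num 0)) (const (.num 1)) hf.snd.toNat

theorem PolyTime.simulateLayer : PolyTime fun w => simulateLayer w.fst w.snd := by
  have n₀ := (id.fst.fst.fst.fst).ratNum
  have d₀ := (id.fst.fst.fst.fst).ratDen
  have n₁ := (id.fst.fst.snd.fst.fst).ratNum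
  have d₁ := (id.fst.fst.snd.fst.fst).ratDen
  have p₀ := id.fst.snd.fst.toNat
  have p₁ := id.fst.snd.snd.toNat
  exact id.fst.fst.snd.snd.pair (ite_eq id.snd.toNat (const (.num 0)) id.fst.snd
    ((add (mul p₀ (mul n₀ d₁)) (mul p₁ (mul (sub d₁ n₁) d₀))).pair
      (add (mul p₀ (mul (sub d₀ n₀) d₁)) (mul p₁ (mul n₁ d₀)))))

/-- The result of the simulation of a policy of the first agent on an example: two numbers that are
proportional to the probabilities of the parities `0` and `1`. -/
def simulate (π x : Val) : Val :=
  (x.toList.foldl simulateLayer (.pair π (.pair (.num 1) (.num 0)))).snd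

theorem PolyTime.simulate {π x : Val → Val} (hπ : PolyTime π) (hx : PolyTime x) :
    PolyTime fun v => simulate (π v) (x v) := by
  refine (foldl (g := fun _ acc b => CollabMDP.simulateLayer acc b) hx
    (hπ.pair (const (.pair (.num 1) (.num 0))))
    (simulateLayer.comp id.snd) ?_).snd
  obtain ⟨L, hL⟩ := hx.size_le
  obtain ⟨A, hA⟩ := hπ.size_le
  -- In every layer the sum of the two numbers grows at most by the factor `4 * (2 ^ size) ^ 2`.
  have key (v : Val) (l₁ : List Val) : ∃ (P₀ P₁ : ℕ) (r : Val),
      l₁.foldl CollabMDP.simulateLayer (.pair (π v) (.pair (.num 1) (.num 0))) =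
        .pair r (.pair (.num P₀) (.num P₁)) ∧
        P₀ + P₁ ≤ 2 ^ (l₁.length * (2 * (π v).size + 2)) ∧ r.size ≤ (π v).size := by
    induction l₁ using List.reverseRecOn with
    | nil => exact ⟨_, _, _, rfl, by simp, le_rfl⟩
    | append_singleton l₁ a ih =>
      obtain ⟨P₀, P₁, r, h, hP, hr⟩ := ih
      rw [List.foldl_append, h]
      simp only [List.foldl_cons, List.foldl_nil, CollabMDP.simulateLayer, Val.fst_pair,
        Val.snd_pair, Val.toNat_num, List.length_append, List.length_cons, List.length_nil]
      have hr' : r.snd.snd.size ≤ (π v).size :=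
        r.snd.size_snd_le.trans (r.size_snd_le.trans hr)
      have hmono : 2 ^ (l₁.length * (2 * (π v).size + 2)) ≤
          2 ^ ((l₁.length + (0 + 1)) * (2 * (π v).size + 2)) :=
        Nat.pow_le_pow_right (by norm_num) (Nat.mul_le_mul_right _ (by omega))
      split_ifs
      · exact ⟨_, _, _, rfl, hP.trans hmono, hr'⟩
      · refine ⟨_, _, _, rfl, ?_, hr'⟩
        set B := 2 ^ (π v).size with hB
        have s₀ : r.fst.fst.size ≤ (π v).size :=
          r.fst.size_fst_le.trans (r.size_fst_le.trans hr)
        have s₁ : r.snd.fst.fst.size ≤ (π v).size :=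
          r.snd.fst.size_fst_le.trans (r.snd.size_fst_le.trans (r.size_snd_le.trans hr))
        have b₀ : 2 ^ r.fst.fst.size ≤ B := Nat.pow_le_pow_right (by norm_num) s₀
        have b₁ : 2 ^ r.snd.fst.fst.size ≤ B := Nat.pow_le_pow_right (by norm_num) s₁
        have hn₀ := r.fst.fst.ratNum_lt.le.trans b₀
        have hd₀ := r.fst.fst.ratDen_lt.le.trans b₀
        have hn₁ := r.snd.fst.fst.ratNum_lt.le.trans b₁
        have hd₁ := r.snd.fst.fst.ratDen_lt.le.trans b₁
        have m₁ := Nat.mul_le_mul_left P₀ (Nat.mul_le_mul hn₀ hd₁)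
        have m₂ := Nat.mul_le_mul_left P₁
          (Nat.mul_le_mul ((Nat.sub_le _ r.snd.fst.fst.ratNum).trans hd₁) hd₀)
        have m₃ := Nat.mul_le_mul_left P₀
          (Nat.mul_le_mul ((Nat.sub_le _ r.fst.fst.ratNum).trans hd₀) hd₁)
        have m₄ := Nat.mul_le_mul_left P₁ (Nat.mul_le_mul hn₁ hd₀)
        have e : 2 ^ ((l₁.length + (0 + 1)) * (2 * (π v).size + 2)) =
            2 ^ (l₁.length * (2 * (π v).size + 2)) * (4 * (B * B)) := by
          rw [hB]; ring
        rw [e]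
        refine le_trans ?_ (Nat.mul_le_mul_right _ hP)
        nlinarith
  refine ⟨A + 2 * (L * (2 * A + 2) + 2) + 3, fun v l₁ hl₁ => ?_⟩
  obtain ⟨P₀, P₁, r, h, hP, hr⟩ := key v l₁
  rw [h]
  have h₁ : l₁.length ≤ L.eval v.size :=
    hl₁.length_le.trans ((x v).length_toList_le.trans (hL v))
  have h₂ := hA v
  have h₃ : l₁.length * (2 * (π v).size + 2) ≤ L.eval v.size * (2 * A.eval v.size + 2) := by
    gcongr
  have hsize (P : ℕ) (h : P ≤ 2 ^ (l₁.length * (2 * (π v).size + 2))) :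
      Nat.size P ≤ l₁.length * (2 * (π v).size + 2) + 1 :=
    Nat.size_le.2 (h.trans_lt (Nat.pow_lt_pow_right (by norm_num) (by omega)))
  have h₄ : Nat.size P₀ ≤ l₁.length * (2 * (π v).size + 2) + 1 :=
    hsize _ (by omega)
  have h₅ : Nat.size P₁ ≤ l₁.length * (2 * (π v).size + 2) + 1 :=
    hsize _ (by omega)
  simp only [Val.size, Polynomial.eval_add, Polynomial.eval_mul, Polynomial.eval_ofNat]
  omega

theorem Val.nth_eq (v : Val) (i : ℕ) : v.nth i = (Val.snd^[i] v).fst := by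
  induction i generalizing v with
  | zero => rfl
  | succ i ih => rw [Val.nth, ih, Function.iterate_succ_apply]

/-- The simulation computes the probabilities of the two parities, up to a common factor. -/
theorem simulate_eq {n k : ℕ} {π : Policy ℚ (2 * n + 3) (k + 2)} {v : Val}
    (hv : π.IsDescribedBy v) (x : ℕ → Bool) : ∃ P₀ P₁ : ℕ,
      simulate v (.ofFn fun i : Fin n => .ofBool (x i)) = .pair (.num P₀) (.num P₁) ∧
      0 < P₀ + P₁ ∧ (P₁ : ℚ) = parityProb (stayProb π) x n * (P₀ + P₁ : ℕ) := by
  have key (m : ℕ) (hm : m ≤ n) : ∃ P₀ P₁ : ℕ,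
      ((List.range m).map fun i => Val.ofBool (x i)).foldl simulateLayer
        (.pair v (.pair (.num 1) (.num 0))) =
        .pair (Val.snd^[2 * m] v) (.pair (.num P₀) (.num P₁)) ∧
      0 < P₀ + P₁ ∧ (P₁ : ℚ) = parityProb (stayProb π) x m * (P₀ + P₁ : ℕ) := by
    induction m with
    | zero => exact ⟨1, 0, rfl, by norm_num, by simp [parityProb]⟩
    | succ m ih =>
      obtain ⟨P₀, P₁, h, hpos, hp⟩ := ih (by omega)
      rw [List.range_succ, List.map_append, List.foldl_append, h]
      simp only [List.map_cons, List.map_nil, List.foldl_cons, List.foldl_nil, simulateLayer,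
        Val.fst_pair, Val.snd_pair, Val.toNat_num, toNat_ofBool]
      have e₁ : (Val.snd^[2 * m] v).snd.snd = Val.snd^[2 * (m + 1)] v := by
        rw [show 2 * (m + 1) = 2 * m + 1 + 1 by ring, Function.iterate_succ_apply',
          Function.iterate_succ_apply']
      have e₂ : (Val.snd^[2 * m] v).snd.fst = v.nth (2 * m + 1) := by
        rw [Val.nth_eq, Function.iterate_succ_apply']
      rw [e₁, e₂, ← Val.nth_eq]
      have hq (s : ℕ) (hs : s < 2 * n) : ∃ a b : ℕ, (v.nth s).fst.ratNum = a ∧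
          (v.nth s).fst.ratDen = b ∧ a ≤ b ∧ 0 < b ∧ (a : ℚ) = stayProb π s * b := by
        have hb := (v.nth s).fst.ratDen_pos
        have h₁ : ((v.nth s).fst.ratNum : ℚ) / (v.nth s).fst.ratDen = stayProb π s := by
          rw [Val.ratNum_div_ratDen, stayProb, dif_pos (by omega)]
          exact hv ⟨s, by omega⟩ 0
        have hb' : (0 : ℚ) < (v.nth s).fst.ratDen := by exact_mod_cast hb
        have h₂ := (div_eq_iff hb'.ne').1 h₁
        have h₃ : stayProb π s ≤ 1 := by
          rw [stayProb, dif_pos (by omega), ← (π ⟨s, by omega⟩).2.2]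
          exact Finset.single_le_sum (f := fun a => π ⟨s, by omega⟩ a)
            (fun a _ => (π ⟨s, by omega⟩).2.1 a) (Finset.mem_univ _)
        refine ⟨_, _, rfl, rfl, ?_, hb, h₂⟩
        have : ((v.nth s).fst.ratNum : ℚ) ≤ (v.nth s).fst.ratDen := by
          rw [h₂]
          exact mul_le_of_le_one_left hb'.le h₃
        exact_mod_cast this
      obtain ⟨a₀, b₀, ha₀, hb₀, hab₀, hbpos₀, hqq₀⟩ := hq (2 * m) (by omega)
      obtain ⟨a₁, b₁, ha₁, hb₁, hab₁, hbpos₁, hqq₁⟩ := hq (2 * m + 1) (by omega)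
      rw [ha₀, hb₀, ha₁, hb₁]
      cases hx : x m
      · exact ⟨P₀, P₁, by simp, hpos, by simpa [parityProb, hx] using hp⟩
      · refine ⟨_, _, congrArg _ (if_neg (by simp)), ?_, ?_⟩
        all_goals
          obtain ⟨c₀, rfl⟩ := Nat.exists_eq_add_of_le hab₀
          obtain ⟨c₁, rfl⟩ := Nat.exists_eq_add_of_le hab₁
          rw [Nat.add_sub_cancel_left, Nat.add_sub_cancel_left]
        · have : 0 < (P₀ + P₁) * ((a₀ + c₀) * (a₁ + c₁)) := by positivity
          nlinarith
        · rw [parityProb, if_pos hx]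
          push_cast at hp hqq₀ hqq₁ ⊢
          set p := parityProb (stayProb π) x m
          set q₀ := stayProb π (2 * m)
          set q₁ := stayProb π (2 * m + 1)
          have hc₀ : (c₀ : ℚ) = (1 - q₀) * (a₀ + c₀) := by linarith
          have hc₁ : (c₁ : ℚ) = (1 - q₁) * (a₁ + c₁) := by linarith
          have hP₀ : (P₀ : ℚ) = (1 - p) * (P₀ + P₁) := by linarith
          have e₁ : (P₀ * (c₀ * (a₁ + c₁)) : ℚ) =
              (1 - p) * (P₀ + P₁) * ((1 - q₀) * (a₀ + c₀) * (a₁ + c₁)) := by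
            rw [← hc₀, ← hP₀]
          have e₂ : (P₁ * (a₁ * (a₀ + c₀)) : ℚ) =
              p * (P₀ + P₁) * (q₁ * (a₁ + c₁) * (a₀ + c₀)) := by
            rw [← hqq₁, ← hp]
          have e₃ : (P₀ * (a₀ * (a₁ + c₁)) + P₁ * (c₁ * (a₀ + c₀)) +
              (P₀ * (c₀ * (a₁ + c₁)) + P₁ * (a₁ * (a₀ + c₀))) : ℚ) =
              (P₀ + P₁) * (a₀ + c₀) * (a₁ + c₁) := by ring
          rw [e₃, e₁, e₂]
          ring
  rw [simulate, Val.ofFn_eq_map_range fun i => .ofBool (x i), Val.toList_ofList]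
  obtain ⟨P₀, P₁, h, hpos, hp⟩ := key n le_rfl
  exact ⟨P₀, P₁, by rw [h]; rfl, hpos, hp⟩

end CollabMDP

/-! ### The learner -/

namespace CollabMDP

/-- The input of the first agent, computed from the input of the learner. The first `n + T` random
bits are set aside. -/
def prepare (k₁ k₂ : ℕ) (v : Val) : Val :=
  .ofList [.num (2 * v.snd.snd.snd.fst.toList.length + 3), .num (2 * v.snd.fst.toNat),
    (parityMDP v.snd.snd.snd.fst.toList.length (k₁ + 2) (k₂ + 2)).encode,
    .ofList (v.snd.snd.fst.toList.map (policyOfExample k₂)),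
    (splitBits (v.fst.toNat + v.snd.fst.toNat) v.snd.snd.snd.snd.fst).snd]

theorem PolyTime.prepare (k₁ k₂ : ℕ) : PolyTime (prepare k₁ k₂) :=
  have hx := id.snd.snd.snd.fst
  (add (mul (const (.num 2)) hx.length) (const (.num 3))).pair
    ((mul (const (.num 2)) id.snd.fst.toNat).pair ((encode_parityMDP hx _ _).pair
      ((map (g := fun _ => CollabMDP.policyOfExample k₂) id.snd.snd.fst
        ((policyOfExample k₂).comp id.snd)).pair
        ((splitBits (m := fun v => .num (v.fst.toNat + v.snd.fst.toNat))
          (add id.fst.toNat id.snd.fst.toNat) id.snd.snd.snd.snd.fst).snd.pair (const (.num 0))))))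

/-- The prediction of the learner, computed from a policy of the first agent and from the input of
the learner: the label is `1` if the random threshold lies below the probability that the parity
under the policy is `1`. -/
def predict (w : Val) : Val :=
  let U := (splitBits (w.snd.fst.toNat + w.snd.snd.fst.toNat) w.snd.snd.snd.snd.snd.fst).fst
  let P := simulate w.fst w.snd.snd.snd.snd.fst
  if U.fst.toNat * (P.fst.toNat + P.snd.toNat) < P.snd.toNat * U.snd.toNat then .num 1 else .num 0

theorem PolyTime.predict : PolyTime predict :=
  have hU := (splitBits (m := fun w => .num (w.snd.fst.toNat + w.snd.snd.fst.toNat))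
    (add id.snd.fst.toNat id.snd.snd.fst.toNat) id.snd.snd.snd.snd.snd.fst).fst
  have hP := simulate id.fst id.snd.snd.snd.snd.fst
  ite_lt (mul hU.fst.toNat (add hP.fst.toNat hP.snd.toNat)) (mul hP.snd.toNat hU.snd.toNat)
    (const _) (const _)

/-- A vector of bits, extended by zeros. -/
def extendBits {n : ℕ} (x : Fin n → Bool) (i : ℕ) : Bool := if h : i < n then x ⟨i, h⟩ else false

theorem extendBits_val {n : ℕ} (x : Fin n → Bool) (i : Fin n) : extendBits x i = x i := dif_pos i.2

section

variable {n l : ℕ} {T : ℕ} {x : ℕ → Fin n → Bool} {y : ℕ → Bool} {t : ℕ}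

theorem prepare_learnerInput {k₁ k₂ : ℕ} (σ : Fin (n + T) → Bool) (τ : Fin l → Bool)
    {π₂ : ℕ → Policy ℚ (2 * n + 3) (k₂ + 2)}
    (hπ₂ : ∀ i < t, π₂ i = Policy.ofBits (exampleBits n (extendBits (x i)) (y i))) :
    prepare k₁ k₂ (learnerInput T x y t (Fin.append σ τ)) =
      agentInput (2 * T) (parityMDP n (k₁ + 2) (k₂ + 2)) π₂ t τ := by
  have hlen : (Val.ofFn fun j => Val.ofBool (x t j)).toList.length = n := by simp [Val.ofFn]
  have h := splitBits_eq σ τ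
  simp only [prepare, learnerInput, Val.ofList, Val.fst_pair, Val.snd_pair, Val.toNat_num, h,
    agentInput, Val.toList_ofList, List.map_map]
  rw [hlen]
  congr 4
  refine congrArg Val.ofList (List.map_congr_left fun i hi => ?_)
  rw [hπ₂ i (List.mem_range.1 hi), ← policyOfExample_eq]
  simp only [Function.comp_apply, extendBits_val]

theorem predict_learnerInput {k : ℕ} (σ : Fin (n + T) → Bool) (τ : Fin l → Bool)
    {π : Policy ℚ (2 * n + 3) (k + 2)} {v : Val} (hv : π.IsDescribedBy v) :
    predict (.pair v (learnerInput T x y t (Fin.append σ τ))) =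
      .ofBool (decide ((bitsValue σ : ℚ) <
        parityProb (stayProb π) (extendBits (x t)) n * 2 ^ (n + T))) := by
  obtain ⟨P₀, P₁, hP, hpos, hp⟩ := simulate_eq hv (extendBits (x t))
  simp only [extendBits_val] at hP
  have h := splitBits_eq σ τ
  simp only [predict, learnerInput, Val.ofList, Val.fst_pair, Val.snd_pair, Val.toNat_num, h, hP]
  have hpos' : (0 : ℚ) < (P₀ + P₁ : ℕ) := by exact_mod_cast hpos
  have hiff : bitsValue σ * (P₀ + P₁) < P₁ * 2 ^ (n + T) ↔ (bitsValue σ : ℚ) <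
      parityProb (stayProb π) (extendBits (x t)) n * 2 ^ (n + T) := by
    rw [← mul_lt_mul_iff_left₀ hpos', mul_right_comm, ← hp]
    exact_mod_cast Iff.rfl
  by_cases hlt : bitsValue σ * (P₀ + P₁) < P₁ * 2 ^ (n + T)
  · rw [if_pos hlt, decide_eq_true (hiff.1 hlt)]
    rfl
  · rw [if_neg hlt, decide_eq_false (mt hiff.2 hlt)]
    rfl

theorem size_ofBool_le (b : Bool) : (Val.ofBool b).size ≤ 2 := by
  cases b <;> simp [Val.ofBool, Val.size]

theorem size_ofFn_ofBool_le {m : ℕ} (f : Fin m → Bool) :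
    (Val.ofFn fun i => .ofBool (f i)).size ≤ m * 3 + 1 := by
  refine (Val.size_ofList_le (B := 2) ?_).trans (by simp)
  intro a ha
  obtain ⟨i, rfl⟩ := (List.mem_ofFn' _ _).1 ha
  exact size_ofBool_le _

theorem size_learnerInput_le (σ : Fin l → Bool) (ht : t < T) :
    (learnerInput T x y t σ).size ≤ (n + T) * (3 * (n + T) + 13) + 3 * l + 20 := by
  have hsize (k : ℕ) : Nat.size k ≤ k := Nat.size_le.2 Nat.lt_two_pow_self
  have h₁ := hsize n
  have h₂ := hsize T
  have h₃ := size_ofFn_ofBool_le (x t)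
  have h₄ := size_ofFn_ofBool_le σ
  have h₅ : (Val.ofList ((List.range t).map fun i =>
      .pair (.ofFn fun j => .ofBool (x i j)) (.ofBool (y i)))).size ≤ t * (3 * n + 4 + 1) + 1 := by
    refine (Val.size_ofList_le (B := 3 * n + 4) ?_).trans (by simp)
    intro a ha
    obtain ⟨i, -, rfl⟩ := List.mem_map.1 ha
    have := size_ofFn_ofBool_le (x i)
    have := size_ofBool_le (y i)
    simp only [Val.size]
    omega
  have h₆ : t * (3 * n + 4 + 1) ≤ (n + T) * (3 * (n + T) + 5) :=
    Nat.mul_le_mul (by omega) (by omega)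
  simp only [learnerInput, Val.ofList, Val.size]
  have : Nat.size 0 = 0 := Nat.size_zero
  have h₇ : (n + T) * (3 * (n + T) + 13) = (n + T) * (3 * (n + T) + 5) + 8 * (n + T) := by ring
  omega

end

/-- The learner runs the algorithm of the first agent on the parity MDP, with its random bits after
the first `n + T` ones. -/
theorem exists_learner (k₁ k₂ : ℕ) (A : Prog) (coins time : Polynomial ℕ) :
    ∃ (B : Prog) (time' : Polynomial ℕ), ∀ {n T t : ℕ} {x : ℕ → Fin n → Bool} {y : ℕ → Bool}
      {σ : Fin (n + T) → Bool} {τ : Fin (coins.eval (2 * n + 3 + 2 * T)) → Bool}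
      {π₂ : ℕ → Policy ℚ (2 * n + 3) (k₂ + 2)} {π : Policy ℚ (2 * n + 3) (k₁ + 2)} {v : Val}
      {s : ℕ}, t < T →
      (∀ i < t, π₂ i = Policy.ofBits (exampleBits n (extendBits (x i)) (y i))) →
      Run A (agentInput (2 * T) (parityMDP n (k₁ + 2) (k₂ + 2)) π₂ t τ) v s →
      s ≤ time.eval (2 * n + 3 + 2 * T) → π.IsDescribedBy v →
      ∃ s', Run B (learnerInput T x y t (Fin.append σ τ))
        (.ofBool (decide ((bitsValue σ : ℚ) <
          parityProb (stayProb π) (extendBits (x t)) n * 2 ^ (n + T)))) s' ∧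
        s' ≤ time'.eval (n + T) := by
  obtain ⟨p, q, hp⟩ := PolyTime.prepare k₁ k₂
  obtain ⟨p', q', hp'⟩ := PolyTime.predict
  obtain ⟨S, hS⟩ : ∃ S : Polynomial ℕ, ∀ {n T t : ℕ} {x : ℕ → Fin n → Bool} {y : ℕ → Bool}
      {σ : Fin (n + T) → Bool} {τ : Fin (coins.eval (2 * n + 3 + 2 * T)) → Bool}, t < T →
      (learnerInput T x y t (Fin.append σ τ)).size ≤ S.eval (n + T) := by
    refine ⟨Polynomial.X * (3 * Polynomial.X + 13) +
      3 * (Polynomial.X + coins.comp (2 * Polynomial.X + 3)) + 20,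
      fun {n T t x y σ τ} ht => (size_learnerInput_le _ ht).trans (le_of_eq ?_)⟩
    have : 2 * (n + T) + 3 = 2 * n + 3 + 2 * T := by ring
    simp [this]
  set V : Polynomial ℕ := time.comp (2 * Polynomial.X + 3) with hV
  refine ⟨.comp p' (.pair (.comp A p) (.op .id)),
    (q.comp S + V + 1 + (S + S) + S + 1) + q'.comp (V + S + 1) + 1, ?_⟩
  intro n T t x y σ τ π₂ π v s ht hπ₂ hrun hs hv
  set u := learnerInput T x y t (Fin.append σ τ) with hu
  have hus : u.size ≤ S.eval (n + T) := hS ht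
  obtain ⟨r, hr, hrq⟩ := hp u
  rw [prepare_learnerInput σ τ hπ₂] at hr
  obtain ⟨r', hr', hrq'⟩ := hp' (.pair v u)
  rw [predict_learnerInput σ τ hv] at hr'
  refine ⟨_, .comp (.pair (.comp hr hrun) (.op .id u)) hr', ?_⟩
  have hs' : s ≤ V.eval (n + T) := by
    have : 2 * (n + T) + 3 = 2 * n + 3 + 2 * T := by ring
    simpa [hV, this] using hs
  have h₁ : r ≤ q.eval (S.eval (n + T)) := hrq.trans (monotone_eval q hus)
  have h₂ : r' ≤ q'.eval (V.eval (n + T) + S.eval (n + T) + 1) := by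
    refine hrq'.trans (monotone_eval q' ?_)
    have := hrun.size_le
    simp only [Val.size]
    omega
  simp only [Op.eval, Polynomial.eval_add, Polynomial.eval_comp, Polynomial.eval_one]
  omega

end CollabMDP

/-! ### From the regret of the first agent to the regret of the learner -/

namespace CollabMDP

theorem parityProb_ratCast (q : ℕ → ℚ) (x : ℕ → Bool) (i : ℕ) :
    parityProb (fun s => (q s : ℝ)) x i = ((parityProb q x i : ℚ) : ℝ) := by
  induction i with
  | zero => simp [parityProb]
  | succ i ih =>
    unfold parityProb
    split_ifs
    · rw [ih]; push_cast; rfl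
    · exact ih

theorem stayProb_toReal {N k : ℕ} (π : Policy ℚ N (k + 2)) :
    stayProb π.toReal = fun s => ((stayProb π s : ℚ) : ℝ) := by
  funext s
  unfold stayProb
  split_ifs
  · rfl
  · simp

/-- A random threshold with `m` bits lies below a given probability with nearly this
probability. -/
theorem expect_threshold_ne_le (m : ℕ) {p : ℚ} (hp₀ : 0 ≤ p) (hp₁ : p ≤ 1) (y : Bool) :
    (𝔼 σ : Fin m → Bool, if decide ((bitsValue σ : ℚ) < p * 2 ^ m) ≠ y then (1 : ℝ) else 0) ≤
      (if y then 1 - (p : ℝ) else (p : ℝ)) + 1 / 2 ^ m := by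
  set e : (Fin m → Bool) ≃ Fin (2 ^ m) :=
    (Equiv.arrowCongr (Equiv.refl _) finTwoEquiv.symm).trans finFunctionFinEquiv with he
  have hval (σ : Fin m → Bool) : ((e σ : Fin (2 ^ m)) : ℕ) = bitsValue σ := by
    rw [he, Equiv.trans_apply, finFunctionFinEquiv_apply, bitsValue]
    refine Finset.sum_congr rfl fun i _ => ?_
    congr 1
    simp only [Equiv.arrowCongr_apply, Equiv.refl_symm, Equiv.coe_refl, Function.comp_apply, id]
    cases σ i <;> rfl
  set K := ⌈p * 2 ^ m⌉₊ with hK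
  have hKle : K ≤ 2 ^ m := by
    refine Nat.ceil_le.2 ?_
    push_cast
    exact mul_le_of_le_one_left (by positivity) hp₁
  have hK₁ : (p : ℝ) * 2 ^ m ≤ K := by
    have : p * 2 ^ m ≤ K := Nat.le_ceil _
    exact_mod_cast this
  have hK₂ : (K : ℝ) ≤ (p : ℝ) * 2 ^ m + 1 := by
    have : (K : ℚ) ≤ p * 2 ^ m + 1 := (Nat.ceil_lt_add_one (by positivity)).le
    exact_mod_cast this
  have h2 : (0 : ℝ) < 2 ^ m := by positivity
  rw [Fintype.expect_equiv e _
    (fun u : Fin (2 ^ m) => if decide ((u : ℕ) < K) ≠ y then (1 : ℝ) else 0) (fun σ => by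
      rw [hval, hK]
      simp only [Nat.lt_ceil])]
  rw [Fintype.expect_eq_sum_div_card, Fintype.card_fin,
    Fin.sum_univ_eq_sum_range (fun u => if decide (u < K) ≠ y then (1 : ℝ) else 0),
    Finset.sum_boole]
  push_cast
  rw [div_le_iff₀ h2, add_mul, one_div, inv_mul_cancel₀ h2.ne']
  cases y
  · have : (Finset.range (2 ^ m)).filter (fun u => decide (u < K) ≠ false) = Finset.range K := by
      ext u; simp; omega
    rw [this, Finset.card_range]
    simpa using hK₂
  · have : (Finset.range (2 ^ m)).filter (fun u => decide (u < K) ≠ true) =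
        Finset.Ico K (2 ^ m) := by
      ext u; simp; omega
    rw [this, Nat.card_Ico, Nat.cast_sub hKle]
    push_cast
    simp only [if_true]
    linarith

section

variable {n k₁ k₂ : ℕ}

/-- The policies of the second agent: in the episodes `t < T` they stand for the labelled examples.
In the later episodes the example and the label are zero, except that in episode `T` the action in
the transient state `1` differs from that in episode `T - 1`, so that the policy changes by the
maximal amount. -/
def secondAgent (k₂ : ℕ) (T : ℕ) (x : ℕ → Fin n → Bool) (y : ℕ → Bool) (t : ℕ) :
    Policy ℚ (2 * n + 3) (k₂ + 2) :=
  if t < T then Policy.ofBits (exampleBits n (extendBits (x t)) (y t))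
  else Policy.ofBits fun s => decide (s = 1) && !extendBits (x (T - 1)) 0

theorem exampleBits_even {x : ℕ → Bool} {y : Bool} {i : ℕ} (hi : i < n) :
    exampleBits n x y (2 * i) = x i := by
  rw [exampleBits, if_pos (by omega), Nat.mul_div_cancel_left _ (by norm_num)]

theorem exampleBits_odd {x : ℕ → Bool} {y : Bool} {i : ℕ} (hi : i < n) :
    exampleBits n x y (2 * i + 1) = x i := by
  rw [exampleBits, if_pos (by omega), show (2 * i + 1) / 2 = i by omega]

theorem sum_abs_ofBits_sub {N k : ℕ} {z z' : ℕ → Bool} (s : Fin N) (h : z s ≠ z' s) :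
    ∑ a, |(Policy.ofBits z : Policy ℚ N (k + 2)).toReal s a -
      (Policy.ofBits z' : Policy ℚ N (k + 2)).toReal s a| = 2 := by
  simp_rw [Policy.toReal_apply, Policy.ofBits_apply]
  rw [Fin.sum_univ_succ, Fin.sum_univ_succ]
  cases hz : z s <;> cases hz' : z' s
  · exact absurd (hz.trans hz'.symm) h
  · simp [Fin.succ_succ_ne_one, Fin.succ_ne_zero]; norm_num
  · simp [Fin.succ_succ_ne_one, Fin.succ_ne_zero]; norm_num
  · exact absurd (hz.trans hz'.symm) h

theorem weight_le (n s : ℕ) (f g : Bool) (s' : ℕ) : weight n s f g s' ≤ 2 * n + 3 := by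
  unfold weight
  split_ifs <;> omega

theorem HasBitLength.of_le {b : ℕ} {q : ℚ} (h₁ : q.num.toNat ≤ b) (h₂ : q.den ≤ b) :
    HasBitLength b q :=
  ⟨Nat.size_le.2 (h₁.trans_lt Nat.lt_two_pow_self),
    Nat.size_le.2 (h₂.trans_lt Nat.lt_two_pow_self)⟩

theorem hasBitLength_weight {b : ℕ} (hb : 2 * n + 3 ≤ b) (s : ℕ) (f g : Bool) (s' : ℕ) :
    HasBitLength b ((weight n s f g s' : ℚ) / (2 * n + 3 : ℕ)) := by
  have h := ofRat_weight n s f g s'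
  have hw := weight_le n s f g s'
  rw [Val.ofRat] at h
  split_ifs at h
  all_goals
    injection h with h₁ h₂
    injection h₁ with h₁
    injection h₂ with h₂
    exact .of_le (by omega) (by omega)

theorem hasBitLength_ite {b : ℕ} (hb : 1 ≤ b) (c : Prop) [Decidable c] :
    HasBitLength b (if c then 1 else 0) := by
  split_ifs <;> exact .of_le (by simp [hb]) (by simp [hb])

theorem isInstance_parityMDP (hn : 1 ≤ n) {T : ℕ} (hT : 1 ≤ T) (x : ℕ → Fin n → Bool)
    (y : ℕ → Bool) {e : ℕ} (he : 1 ≤ e) {c : ℝ} (hc : c ≤ 2) :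
    IsInstance e c (2 * T) (parityMDP n (k₁ + 2) (k₂ + 2)) (secondAgent k₂ T x y) := by
  have hb : 2 * n + 3 ≤ (2 * n + 3 + 2 * T) ^ e :=
    le_trans (by omega) (Nat.le_self_pow (by omega) _)
  refine ⟨⟨_, parityMDP_hasMixingTime hn, ?_⟩, fun s a₁ a₂ s' => hasBitLength_weight hb _ _ _ _,
    fun s a₁ a₂ => hasBitLength_ite (by omega) _, fun t _ s a => ?_, parityMDP_influence₂ hn, ?_⟩
  · have : 2 * n + 3 ≤ (2 * n + 3) ^ e := Nat.le_self_pow (by omega) _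
    exact_mod_cast this
  · unfold secondAgent
    split_ifs <;> rw [Policy.ofBits_apply] <;> exact hasBitLength_ite (by omega) _
  · have hT' : T - 1 < 2 * T - 1 := by omega
    have h1 : 1 < 2 * n + 3 := by omega
    refine le_trans ?_ (le_ciSup (f := fun t : Fin (2 * T - 1) => rowSumNorm fun s a =>
      (secondAgent k₂ T x y (t + 1)).toReal s a - (secondAgent k₂ T x y t).toReal s a)
      (Set.finite_range _).bddAbove ⟨T - 1, hT'⟩)
    refine le_trans ?_ (le_rowSumNorm _ ⟨1, h1⟩)
    simp only [secondAgent]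
    rw [if_neg (by omega), if_pos (by omega), sum_abs_ofBits_sub]
    · exact hc
    · have := exampleBits_odd (x := extendBits (x (T - 1))) (y := y (T - 1)) (i := 0)
        (n := n) (by omega)
      simp only [mul_zero, zero_add] at this
      simp [this]

/-- In every episode `t < T` the reward of a parity function exceeds the reward of the first
agent in proportion to the difference of their error probabilities; in the later episodes all
parity functions are optimal. -/
theorem le_regret_parityMDP (hn : 1 ≤ n) (T : ℕ) (x : ℕ → Fin n → Bool) (y : ℕ → Bool)
    (π₁ : ℕ → Policy ℝ (2 * n + 3) (k₁ + 2)) (I : Finset (Fin n)) :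
    lastLayerProb n * (∑ t ∈ Finset.range T,
        (if y t then 1 - parityProb (stayProb (π₁ t)) (extendBits (x t)) n
          else parityProb (stayProb (π₁ t)) (extendBits (x t)) n) -
      (mistakes T (fun t => parity I (x t)) y : ℝ)) ≤
    (parityMDP n (k₁ + 2) (k₂ + 2)).regret (2 * T) π₁ fun t => (secondAgent k₂ T x y t).toReal := by
  set γ := lastLayerProb n with hγ
  have hγ0 : 0 ≤ γ := le_trans (by positivity) inv_sq_le_lastLayerProb
  set M := parityMDP n (k₁ + 2) (k₂ + 2) with hM
  have hreal (π : Policy ℝ (2 * n + 3) (k₁ + 2)) {t : ℕ} (ht : t < T) :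
      M.avgReward π (secondAgent k₂ T x y t).toReal = γ *
        (if y t then parityProb (stayProb π) (extendBits (x t)) n
          else 1 - parityProb (stayProb π) (extendBits (x t)) n) := by
    rw [secondAgent, if_pos ht]
    exact avgReward_parityMDP hn π (fun i hi => exampleBits_even hi)
      (fun i hi _ => exampleBits_odd hi) (by simp [exampleBits]) (by simp [exampleBits])
  have hdummy (π : Policy ℝ (2 * n + 3) (k₁ + 2)) {t : ℕ} (ht : ¬ t < T) :
      M.avgReward π (secondAgent k₂ T x y t).toReal = γ := by
    rw [secondAgent, if_neg ht]
    have hzero (q : ℕ → ℝ) (i : ℕ) : parityProb q (fun _ => false) i = 0 := by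
      induction i with
      | zero => rfl
      | succ i ih => simpa [parityProb] using ih
    have h := avgReward_parityMDP (k₂ := k₂) hn π (x := fun _ => false) (y := false)
      (z := fun s => decide (s = 1) && !extendBits (x (T - 1)) 0)
      (fun i hi => by simp) (fun i hi _ => by simp; omega) (by simp)
      (by simp; omega)
    rw [h, hzero]
    simp [hγ]
  have hle (π : Policy ℝ (2 * n + 3) (k₁ + 2)) (t : ℕ) :
      M.avgReward π (secondAgent k₂ T x y t).toReal ≤ γ := by
    by_cases ht : t < T
    · rw [hreal π ht]
      obtain ⟨h₀, h₁⟩ := parityProb_mem_Icc (stayProb_mem_Icc π) (extendBits (x t)) n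
      refine mul_le_of_le_one_right hγ0 ?_
      split_ifs <;> linarith
    · exact (hdummy π ht).le
  have hbdd : BddAbove (Set.range fun π : Policy ℝ (2 * n + 3) (k₁ + 2) =>
      ∑ t ∈ Finset.range (2 * T), (M.avgReward π (secondAgent k₂ T x y t).toReal -
        M.avgReward (π₁ t) (secondAgent k₂ T x y t).toReal)) := by
    refine ⟨∑ t ∈ Finset.range (2 * T),
      (γ - M.avgReward (π₁ t) (secondAgent k₂ T x y t).toReal), ?_⟩
    rintro _ ⟨π, rfl⟩
    exact Finset.sum_le_sum fun t _ => sub_le_sub_right (hle π t) _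
  refine le_trans (le_of_eq ?_) (le_ciSup hbdd (Policy.ofBits (N := 2 * n + 3) (k := k₁)
        fun s => decide (∃ i ∈ I, (i : ℕ) = s / 2)).toReal)
  have hsplit : Finset.range T ⊆ Finset.range (2 * T) :=
    Finset.range_subset_range.2 (by omega)
  rw [← Finset.sum_subset hsplit]
  · rw [mistakes, Finset.card_filter]
    push_cast
    rw [← Finset.sum_sub_distrib, Finset.mul_sum]
    refine Finset.sum_congr rfl fun t ht => ?_
    rw [hreal _ (Finset.mem_range.1 ht), hreal _ (Finset.mem_range.1 ht), ← mul_sub,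
      parityProb_ofBits I (x t) (extendBits_val (x t))]
    congr 1
    cases parity I (x t) <;> cases y t <;> simp
  · intro t _ ht
    have ht' : ¬ t < T := fun h => ht (Finset.mem_range.2 h)
    rw [hdummy _ ht', hdummy _ ht', sub_self]

end

/-- Exponentially small errors are negligible. -/
theorem exists_div_two_pow_le (β : ℝ) :
    ∃ C : ℕ, ∀ T : ℕ, 1 ≤ T → (T : ℝ) / 2 ^ T ≤ C * (T : ℝ) ^ β := by
  set k := ⌈1 - β⌉₊
  obtain ⟨C, hC⟩ := (tendsto_pow_const_div_const_pow_of_one_lt k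
    (one_lt_two (α := ℝ))).bddAbove_range
  obtain ⟨C', hC'⟩ := exists_nat_ge C
  refine ⟨C', fun T hT => ?_⟩
  have hT0 : (0 : ℝ) < T := by exact_mod_cast hT
  have hT1 : (1 : ℝ) ≤ T := by exact_mod_cast hT
  have h₁ : (T : ℝ) ^ k / 2 ^ T ≤ C' := (hC ⟨T, rfl⟩).trans hC'
  have h₂ : (T : ℝ) ≤ (T : ℝ) ^ k * (T : ℝ) ^ β := by
    rw [← Real.rpow_natCast, ← Real.rpow_add hT0]
    refine Real.self_le_rpow_of_one_le hT1 ?_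
    have := Nat.le_ceil (1 - β)
    linarith
  calc (T : ℝ) / 2 ^ T ≤ (T : ℝ) ^ k * (T : ℝ) ^ β / 2 ^ T := by gcongr
    _ = (T : ℝ) ^ k / 2 ^ T * (T : ℝ) ^ β := by ring
    _ ≤ C' * (T : ℝ) ^ β := by gcongr

theorem two_mul_rpow_le {β : ℝ} (hβ : β < 1) (T : ℕ) :
    ((2 * T : ℕ) : ℝ) ^ β ≤ 2 * (T : ℝ) ^ β := by
  push_cast
  rw [Real.mul_rpow (by norm_num) (by positivity)]
  gcongr
  calc (2 : ℝ) ^ β ≤ 2 ^ (1 : ℝ) := Real.rpow_le_rpow_of_exponent_le (by norm_num) hβ.le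
    _ = 2 := Real.rpow_one 2

end CollabMDP

namespace CollabMDP

/-- With a random threshold, the expected number of mistakes is nearly the sum of the error
probabilities. -/
theorem expect_mistakes_le (m T : ℕ) {p : ℕ → ℚ} (hp : ∀ t, 0 ≤ p t ∧ p t ≤ 1) (y : ℕ → Bool) :
    (𝔼 σ : Fin m → Bool,
      (mistakes T (fun t => decide ((bitsValue σ : ℚ) < p t * 2 ^ m)) y : ℝ)) ≤
      ∑ t ∈ Finset.range T, (if y t then 1 - (p t : ℝ) else (p t : ℝ)) + T / 2 ^ m := by
  simp_rw [mistakes, ← Finset.sum_boole]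
  rw [Finset.expect_sum_comm]
  refine (Finset.sum_le_sum fun t _ =>
    expect_threshold_ne_le m (hp t).1 (hp t).2 (y t)).trans (le_of_eq ?_)
  rw [Finset.sum_add_distrib, Finset.sum_const, Finset.card_range, nsmul_eq_mul, mul_one_div]

theorem expect_append {m l : ℕ} (f : (Fin m → Bool) → (Fin l → Bool) → ℝ) :
    (𝔼 σ : Fin (m + l) → Bool,
      f ((Fin.appendEquiv m l).symm σ).1 ((Fin.appendEquiv m l).symm σ).2) =
      𝔼 τ, 𝔼 σ, f σ τ := by
  rw [Fintype.expect_equiv (Fin.appendEquiv m l).symm _ (fun p => f p.1 p.2) fun _ => rfl,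
    Finset.expect_comm, ← Finset.expect_product', Finset.univ_product_univ]

end CollabMDP

/-- If, for some fixed numbers of actions and some lower bound `c` on the policy change magnitude of
the second agent, a polynomial-time algorithm of the first agent has regret `O(poly(N) * T ^ β)` on
all instances with influence `1`, then online agnostic parity learning has a polynomial-time
algorithm with regret `O(poly(n) * T ^ β)`. -/
theorem mainTheorem3 (k₁ k₂ e : ℕ) (hk₁ : 2 ≤ k₁) (hk₂ : 2 ≤ k₂) (he : 1 ≤ e)
    (c : ℝ) (hc : 0 < c) (hc' : c ≤ 2) (β : ℝ) (hβ : β < 1)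
    (h : CollabMDP.HasEfficientAgent k₁ k₂ e c β) :
    CollabMDP.HasEfficientParityLearner β := by
  open CollabMDP in
  obtain ⟨k₁, rfl⟩ := Nat.exists_eq_add_of_le' hk₁
  obtain ⟨k₂, rfl⟩ := Nat.exists_eq_add_of_le' hk₂
  obtain ⟨A, coins, time, bound, hA⟩ := h
  obtain ⟨B, time', hB⟩ := exists_learner k₁ k₂ A coins time
  obtain ⟨C, hC⟩ := exists_div_two_pow_le β
  refine ⟨B, Polynomial.X + coins.comp (2 * Polynomial.X + 3), time',
    (2 * Polynomial.X + 3) ^ 2 * (2 * bound.comp (2 * Polynomial.X + 3)) + Polynomial.C C,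
    fun n T hn hT x y => ?_⟩
  have hcoins : (Polynomial.X + coins.comp (2 * Polynomial.X + 3)).eval (n + T) =
      (n + T) + coins.eval (2 * n + 3 + 2 * T) := by
    have : 2 * (n + T) + 3 = 2 * n + 3 + 2 * T := by ring
    simp [this]
  rw [hcoins]
  obtain ⟨π₁, hrun, hreg⟩ := hA (2 * n + 3) (2 * T) (by omega)
    (parityMDP n (k₁ + 2) (k₂ + 2)) (secondAgent k₂ T x y) (isInstance_parityMDP hn hT x y he hc')
  set p : (Fin (coins.eval (2 * n + 3 + 2 * T)) → Bool) → ℕ → ℚ := fun τ t =>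
    parityProb (stayProb (π₁ τ t)) (extendBits (x t)) n with hp
  have hpr (τ t) : parityProb (stayProb (π₁ τ t).toReal) (extendBits (x t)) n = (p τ t : ℝ) := by
    rw [stayProb_toReal, parityProb_ratCast]
  have hp01 (τ t) : 0 ≤ p τ t ∧ p τ t ≤ 1 := by
    have := parityProb_mem_Icc (stayProb_mem_Icc (π₁ τ t).toReal) (extendBits (x t)) n
    rw [hpr] at this
    exact_mod_cast this
  set P : (Fin (n + T) → Bool) → (Fin (coins.eval (2 * n + 3 + 2 * T)) → Bool) →
      ℕ → Bool := fun σ τ t =>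
    decide ((bitsValue σ : ℚ) < p τ t * 2 ^ (n + T)) with hP
  refine ⟨fun σ => P ((Fin.appendEquiv _ _).symm σ).1 ((Fin.appendEquiv _ _).symm σ).2,
    fun σ t ht => ?_, ?_⟩
  · obtain ⟨⟨σ, τ⟩, rfl⟩ := (Fin.appendEquiv (n + T) _).surjective σ
    simp only [Equiv.symm_apply_apply]
    obtain ⟨v, s, hs, hst, hv⟩ := hrun τ t (by omega)
    exact hB ht (fun i hi => if_pos (hi.trans ht)) hs hst hv
  -- The best parity function of the given sequence.
  obtain ⟨I, hI⟩ := Finite.exists_min fun I : Finset (Fin n) =>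
    mistakes T (fun t => parity I (x t)) y
  set N : ℝ := 2 * n + 3 with hN
  have hN0 : 0 < N := by positivity
  have hγ : 1 / N ^ 2 ≤ lastLayerProb n := inv_sq_le_lastLayerProb
  have hγ0 : 0 < lastLayerProb n := lt_of_lt_of_le (by positivity) hγ
  have hregret (τ) :
      (𝔼 σ, parityRegret T x y (P σ τ)) ≤
        (lastLayerProb n)⁻¹ * (parityMDP n (k₁ + 2) (k₂ + 2)).regret (2 * T)
          (fun t => (π₁ τ t).toReal) (fun t => (secondAgent k₂ T x y t).toReal) +
        T / 2 ^ (n + T) := by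
    have h₁ (σ) : parityRegret T x y (P σ τ) ≤
        (mistakes T (P σ τ) y : ℝ) - (mistakes T (fun t => parity I (x t)) y : ℝ) := by
      refine ciSup_le fun J => ?_
      have : (mistakes T (fun t => parity I (x t)) y : ℝ) ≤
          mistakes T (fun t => parity J (x t)) y := by
        exact_mod_cast hI J
      linarith
    have h₂ := expect_mistakes_le (n + T) T (hp01 τ) y
    have h₃ := le_regret_parityMDP (k₂ := k₂) hn T x y (fun t => (π₁ τ t).toReal) I
    simp_rw [hpr] at h₃
    rw [mul_comm, ← le_div_iff₀ hγ0, div_eq_inv_mul] at h₃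
    calc (𝔼 σ, parityRegret T x y (P σ τ))
        ≤ 𝔼 σ, ((mistakes T (P σ τ) y : ℝ) - (mistakes T (fun t => parity I (x t)) y : ℝ)) :=
          Finset.expect_le_expect fun σ _ => h₁ σ
      _ = (𝔼 σ, (mistakes T (P σ τ) y : ℝ)) - (mistakes T (fun t => parity I (x t)) y : ℝ) := by
          rw [Finset.expect_sub_distrib, Fintype.expect_const]
      _ ≤ _ := by linarith
  have hTβ : 0 ≤ (T : ℝ) ^ β := by positivity
  calc (𝔼 σ, parityRegret T x y
          (P ((Fin.appendEquiv _ _).symm σ).1 ((Fin.appendEquiv _ _).symm σ).2))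
      = 𝔼 τ, 𝔼 σ, parityRegret T x y (P σ τ) :=
        expect_append fun σ τ => parityRegret T x y (P σ τ)
    _ ≤ 𝔼 τ, ((lastLayerProb n)⁻¹ * (parityMDP n (k₁ + 2) (k₂ + 2)).regret (2 * T)
          (fun t => (π₁ τ t).toReal) (fun t => (secondAgent k₂ T x y t).toReal) +
        T / 2 ^ (n + T)) := Finset.expect_le_expect fun τ _ => hregret τ
    _ = (lastLayerProb n)⁻¹ * (𝔼 τ, (parityMDP n (k₁ + 2) (k₂ + 2)).regret (2 * T)
          (fun t => (π₁ τ t).toReal) (fun t => (secondAgent k₂ T x y t).toReal)) +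
        T / 2 ^ (n + T) := by
        rw [Finset.expect_add_distrib, Fintype.expect_const, Finset.mul_expect]
    _ ≤ N ^ 2 * (bound.eval (2 * n + 3) * (2 * (T : ℝ) ^ β)) + C * (T : ℝ) ^ β := by
        refine add_le_add ?_ ?_
        · calc (lastLayerProb n)⁻¹ * (𝔼 τ, (parityMDP n (k₁ + 2) (k₂ + 2)).regret (2 * T)
                (fun t => (π₁ τ t).toReal) (fun t => (secondAgent k₂ T x y t).toReal))
              ≤ (lastLayerProb n)⁻¹ * (bound.eval (2 * n + 3) * ((2 * T : ℕ) : ℝ) ^ β) := by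
                gcongr
            _ ≤ N ^ 2 * (bound.eval (2 * n + 3) * (2 * (T : ℝ) ^ β)) := by
                gcongr
                · rw [inv_le_comm₀ hγ0 (by positivity)]
                  simpa using hγ
                · exact two_mul_rpow_le hβ T
        · refine le_trans ?_ (hC T hT)
          gcongr
          · norm_num
          · omega
    _ = _ := by
        simp [hN]
        ring
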